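/- **Setting.** Let $H_1,H_2$ be complex Hilbert spaces, and let $A_1:\mathcal D(A_1)\subset H_1\to H_1$ and $A:\mathcal D(A)\subset H_2\to H_2$ be strictly positive self-adjoint operators (i.e. $\langle A_1x,x\rangle\ge m\|x\|^2$ on $\mathcal D(A_1)$ for some $m>0$, and likewise for $A$). Put $H_{1,1}=\mathcal D(A_1)$, $H_{1,1/2}=\mathcal D(A_1^{1/2})$ with inner product $\langle A_1^{1/2}u,A_1^{1/2}v\rangle_{H_1}$, and let $H_{1,-1/2}$ be the (anti)dual of $H_{1,1/2}$ with respect to the pivot space $H_1$; define $H_{2,1}$, $H_{2,1/2}$, $H_{2,-1/2}$ in the same way from $A$. Let $A_2\in\mathcal L(H_1,H_{2,-1/2})$ restrict to an operator in $\mathcal L(H_{1,1/2},H_2)$, let $A_2^*\in\mathcal L(H_{2,1/2},H_1)$ be its adjoint, and assume that $A_2^*$ maps $H_{2,1}$ into $H_{1,1/2}$ and that $A=A_2A_2^*$ on $H_{2,1}$. Let $C\in\mathcal L(H_2,H_{1,-1/2})$ restrict to an operator in $\mathcal L(H_{2,1/2},H_1)$, and let $C^*\in\mathcal L(H_{1,1/2},H_2)$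 be its adjoint. Let $\tau>0$, let $H_1^\tau$ be $H_1$ with the inner product $\tau\langle u,v\rangle_{H_1}$, and let $$\mathcal H=H_{1,1/2}\times H_1\times H_2\times H_1^\tau,\qquad \mathcal H_0=H_{1,1/2}\times H_1\times H_2$$ with the sums of the inner products of the factors. Define $$\mathcal A_d\,(u_1,u_2,v,w)=\Big(u_2,\;-A_1u_1-Cv,\;C^*u_2-A_2w,\;\tfrac1\tau A_2^*v-\tfrac1\tau w\Big),\qquad \mathcal D(\mathcal A_d)=H_{1,1}\times H_{1,1/2}\times H_{2,1/2}\times H_{1,1/2}\subset\mathcal H,$$ $$\mathcal A\,(u_1,u_2,v)=\big(u_2,\;-A_1u_1-Cv,\;C^*u_2-Av\big),\qquad \mathcal D(\mathcal A)=H_{1,1}\times H_{1,1/2}\times H_{2,1}\subset\mathcal H_0.$$ **Theorem 2.1.** 1. $\mathcal A_d$, with the domain above, generates a strongly continuous contraction semigroup on $\mathcal H$ if and only if the natural domain $\{w\in H_1: A_2w\in H_2\}$ of $A_2$, as an unbounded operator from $H_1$ to $H_2$, is $H_{1,1/2}$. 2. Without any condition on the natural domain of $A_2$, the operator $\mathcal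 A_d$ is closable and its closure generates a strongly continuous contraction semigroup on $\mathcal H$. 3. $\mathcal A$ generates a strongly continuous contraction semigroup on $\mathcal H_0$. -/

import Mathlib

open Filter Topology
open scoped NNReal

noncomputable section

/-! ## Contraction semigroups and their generators -/

/-- A strongly continuous semigroup of contractions on the space `X`. -/
structure ContractionSemigroup (X : Type*) [NormedAddCommGroup X] [NormedSpace ℂ X] where
  T : ℝ≥0 → X →L[ℂ] X
  map_zero : T 0 = ContinuousLinearMap.id ℂ X
  map_add : ∀ s t, T (s + t) = (T s).comp (T t)
  strongly_continuous : ∀ x, Continuous fun t => T t x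
  contraction : ∀ t, ‖T t‖ ≤ 1

/-- `B` is the infinitesimal generator of `S`: `x` lies in the domain of `B` and `B x = y` exactly
when the difference quotients `(T h x - x) / h` converge to `y` as `h ↓ 0`. -/
def ContractionSemigroup.IsGenerator {X : Type*} [NormedAddCommGroup X] [NormedSpace ℂ X]
    (S : ContractionSemigroup X) (B : X →ₗ.[ℂ] X) : Prop :=
  ∀ x y : X, (x, y) ∈ B.graph ↔
    Tendsto (fun h : ℝ≥0 => ((h : ℝ)⁻¹ : ℂ) • (S.T h x - x)) (𝓝[>] 0) (𝓝 y)

/-- The (unbounded) operator `B` generates a strongly continuous contraction semigroup. -/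
def GeneratesContractionSemigroup {X : Type*} [NormedAddCommGroup X] [NormedSpace ℂ X]
    (B : X →ₗ.[ℂ] X) : Prop :=
  ∃ S : ContractionSemigroup X, S.IsGenerator B

/-! ## Positive self-adjoint operators and their square roots -/

/-- A (strictly) positive self-adjoint operator on the Hilbert space `H`. -/
structure PosSelfAdjoint (H : Type*) [NormedAddCommGroup H] [InnerProductSpace ℂ H]
    [CompleteSpace H] where
  op : H →ₗ.[ℂ] H
  selfAdjoint : IsSelfAdjoint op
  pos : ∃ m : ℝ, 0 < m ∧ ∀ x : op.domain, m * ‖(x : H)‖ ^ 2 ≤ (inner ℂ (op x) (x : H)).re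

namespace PosSelfAdjoint

variable {H : Type*} [NormedAddCommGroup H] [InnerProductSpace ℂ H] [CompleteSpace H]

theorem norm_le (P : PosSelfAdjoint H) :
    ∃ m : ℝ, 0 < m ∧ ∀ x : P.op.domain, m * ‖(x : H)‖ ≤ ‖P.op x‖ := by
  obtain ⟨m, hm, h⟩ := P.pos
  refine ⟨m, hm, fun x => ?_⟩
  have h1 : (inner ℂ (P.op x) (x : H)).re ≤ ‖P.op x‖ * ‖(x : H)‖ :=
    (Complex.re_le_norm _).trans (norm_inner_le_norm _ _)
  rcases eq_or_lt_of_le (norm_nonneg (x : H)) with h0 | h0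
  · rw [← h0]; simp
  · nlinarith [h x]

theorem op_injective (P : PosSelfAdjoint H) : Function.Injective P.op.toFun := by
  obtain ⟨m, hm, h⟩ := P.norm_le
  rw [injective_iff_map_eq_zero]
  intro x hx
  have h1 := h x
  have h2 : P.op x = 0 := hx
  rw [h2, norm_zero] at h1
  have h3 : ‖(x : H)‖ ≤ 0 := by
    by_contra hc
    push Not at hc
    nlinarith
  exact Subtype.ext (norm_le_zero_iff.mp h3)

theorem op_surjective (P : PosSelfAdjoint H) : Function.Surjective P.op.toFun := by
  obtain ⟨m, hm, h⟩ := P.norm_le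
  have hdense := P.selfAdjoint.dense_domain
  have hclosed : IsClosed (LinearMap.range P.op.toFun : Set H) := by
    apply IsSeqClosed.isClosed
    intro y y₀ hy hlim
    choose x hx using hy
    have hx' : ∀ n, P.op (x n) = y n := hx
    have hcau : CauchySeq fun n => (x n : H) := by
      rw [Metric.cauchySeq_iff]
      intro ε hε
      obtain ⟨N, hN⟩ := Metric.cauchySeq_iff.mp hlim.cauchySeq (m * ε) (by positivity)
      refine ⟨N, fun i hi j hj => ?_⟩
      have h1 := hN i hi j hj
      have h2 := h (x i - x j)
      rw [LinearPMap.map_sub, hx', hx', AddSubgroupClass.coe_sub] at h2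
      rw [dist_eq_norm] at h1 ⊢
      exact lt_of_mul_lt_mul_left (h2.trans_lt h1) hm.le
    obtain ⟨x₀, hx₀⟩ := cauchySeq_tendsto_of_complete hcau
    have hg : (x₀, y₀) ∈ P.op.graph := by
      refine P.selfAdjoint.isClosed.mem_of_tendsto (hx₀.prodMk_nhds hlim)
        (Eventually.of_forall fun n => ?_)
      rw [← hx' n]
      exact P.op.mem_graph (x n)
    obtain ⟨z, -, hz⟩ := (LinearPMap.mem_graph_iff _).mp hg
    exact ⟨z, hz⟩
  have horth : (LinearMap.range P.op.toFun)ᗮ = ⊥ := by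
    rw [Submodule.eq_bot_iff]
    intro y hy
    have hy' : ∀ x : P.op.domain, inner ℂ (0 : H) (x : H) = inner ℂ y (P.op x) := fun x => by
      rw [inner_zero_left]
      exact (Submodule.mem_orthogonal' _ _ |>.mp hy _ ⟨x, rfl⟩).symm
    have hmem : y ∈ P.op.adjoint.domain := LinearPMap.mem_adjoint_domain_of_exists y ⟨0, hy'⟩
    have hg : (y, (0 : H)) ∈ P.op.adjoint.graph := by
      rw [← LinearPMap.adjoint_apply_eq hdense ⟨y, hmem⟩ hy']
      exact P.op.adjoint.mem_graph ⟨y, hmem⟩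
    rw [LinearPMap.isSelfAdjoint_def.mp P.selfAdjoint] at hg
    obtain ⟨z, hz1, hz2⟩ := (LinearPMap.mem_graph_iff _).mp hg
    have : z = 0 := P.op_injective (hz2.trans (map_zero P.op.toFun).symm)
    have hz : (z : H) = y := hz1
    rw [← hz, this]; rfl
  have : LinearMap.range P.op.toFun = ⊤ := by
    rw [← hclosed.submodule_topologicalClosure_eq]
    exact Submodule.topologicalClosure_eq_top_iff.mpr horth
  exact LinearMap.range_eq_top.mp this

/-- The bounded inverse `A⁻¹ : H → H`. -/
def inv (P : PosSelfAdjoint H) : H →L[ℂ] H :=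
  let e := (LinearEquiv.ofBijective P.op.toFun ⟨P.op_injective, P.op_surjective⟩).symm
  LinearMap.mkContinuousOfExistsBound (P.op.domain.subtype ∘ₗ e.toLinearMap) (by
    obtain ⟨m, hm, h⟩ := P.norm_le
    refine ⟨m⁻¹, fun y => ?_⟩
    have h1 := h (e y)
    have h2 : P.op (e y) = y :=
      (LinearEquiv.ofBijective P.op.toFun ⟨P.op_injective, P.op_surjective⟩).apply_symm_apply y
    rw [h2] at h1
    rw [inv_mul_eq_div, le_div_iff₀' hm]
    exact h1)

theorem inv_op (P : PosSelfAdjoint H) (x : P.op.domain) : P.inv (P.op x) = x :=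
  congrArg Subtype.val
    ((LinearEquiv.ofBijective P.op.toFun ⟨P.op_injective, P.op_surjective⟩).symm_apply_apply x)

theorem inv_mem (P : PosSelfAdjoint H) (y : H) : P.inv y ∈ P.op.domain :=
  ((LinearEquiv.ofBijective P.op.toFun ⟨P.op_injective, P.op_surjective⟩).symm y).2

theorem op_inv (P : PosSelfAdjoint H) (y : H) : P.op ⟨P.inv y, P.inv_mem y⟩ = y :=
  (LinearEquiv.ofBijective P.op.toFun ⟨P.op_injective, P.op_surjective⟩).apply_symm_apply y

theorem inv_injective (P : PosSelfAdjoint H) : Function.Injective P.inv := fun y z h => by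
  have hs : (⟨P.inv y, P.inv_mem y⟩ : P.op.domain) = ⟨P.inv z, P.inv_mem z⟩ := Subtype.ext h
  rw [← P.op_inv y, ← P.op_inv z, hs]

theorem inv_nonneg (P : PosSelfAdjoint H) : 0 ≤ P.inv := by
  rw [ContinuousLinearMap.nonneg_iff_isPositive, ContinuousLinearMap.isPositive_iff_complex]
  intro y
  obtain ⟨m, hm, h⟩ := P.pos
  have hF : P.op.adjoint.IsFormalAdjoint P.op :=
    LinearPMap.adjoint_isFormalAdjoint P.selfAdjoint.dense_domain
  rw [LinearPMap.isSelfAdjoint_def.mp P.selfAdjoint] at hF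
  have h1 := hF ⟨P.inv y, P.inv_mem y⟩ ⟨P.inv y, P.inv_mem y⟩
  have h2 := h ⟨P.inv y, P.inv_mem y⟩
  rw [P.op_inv] at h1 h2
  have h3 : 0 ≤ (inner ℂ y (P.inv y)).re := le_trans (by positivity) h2
  refine ⟨?_, ?_⟩
  · rw [← h1]
    refine Complex.conj_eq_iff_re.mp ?_
    rw [inner_conj_symm]
    exact h1.symm
  · rw [← h1]; exact h3

/-- `A^(-1/2)`, the nonnegative square root of the bounded nonnegative operator `A⁻¹`. -/
def invSqrt (P : PosSelfAdjoint H) : H →L[ℂ] H := CFC.sqrt P.inv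

theorem invSqrt_invSqrt (P : PosSelfAdjoint H) (x : H) : P.invSqrt (P.invSqrt x) = P.inv x :=
  congrArg (fun T : H →L[ℂ] H => T x) (CFC.sqrt_mul_sqrt_self P.inv P.inv_nonneg)

theorem invSqrt_injective (P : PosSelfAdjoint H) : Function.Injective P.invSqrt := fun x y h =>
  P.inv_injective (by rw [← P.invSqrt_invSqrt, ← P.invSqrt_invSqrt, h])

/-- The unbounded operator `A^(1/2)`: the inverse of `A^(-1/2)`, with domain the range of
`A^(-1/2)`. -/
def sqrt (P : PosSelfAdjoint H) : H →ₗ.[ℂ] H :=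
  { domain := LinearMap.range P.invSqrt.toLinearMap
    toFun := (LinearEquiv.ofInjective P.invSqrt.toLinearMap P.invSqrt_injective).symm.toLinearMap }

theorem invSqrt_mem (P : PosSelfAdjoint H) (y : H) : P.invSqrt y ∈ P.sqrt.domain := ⟨y, rfl⟩

theorem invSqrt_sqrt (P : PosSelfAdjoint H) (x : P.sqrt.domain) : P.invSqrt (P.sqrt x) = x :=
  congrArg Subtype.val
    ((LinearEquiv.ofInjective P.invSqrt.toLinearMap P.invSqrt_injective).apply_symm_apply x)

theorem sqrt_invSqrt (P : PosSelfAdjoint H) (y : H) :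
    P.sqrt ⟨P.invSqrt y, P.invSqrt_mem y⟩ = y :=
  P.invSqrt_injective (P.invSqrt_sqrt _)

/-- `A^(1/2) ∘ A^(1/2) = A`, as unbounded operators. -/
theorem mem_op_graph_iff (P : PosSelfAdjoint H) (x y : H) :
    (x, y) ∈ P.op.graph ↔ ∃ z, (x, z) ∈ P.sqrt.graph ∧ (z, y) ∈ P.sqrt.graph := by
  have hs : ∀ a b : H, (a, b) ∈ P.sqrt.graph ↔ a = P.invSqrt b := fun a b => by
    constructor
    · intro h
      obtain ⟨c, hc1, hc2⟩ := (LinearPMap.mem_graph_iff _).mp h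
      simp only at hc1 hc2
      rw [← hc1, ← hc2, P.invSqrt_sqrt]
    · rintro rfl
      exact (LinearPMap.mem_graph_iff _).mpr ⟨⟨_, P.invSqrt_mem b⟩, rfl, P.sqrt_invSqrt b⟩
  have ha : (x, y) ∈ P.op.graph ↔ x = P.inv y := by
    constructor
    · intro h
      obtain ⟨c, hc1, hc2⟩ := (LinearPMap.mem_graph_iff _).mp h
      simp only at hc1 hc2
      rw [← hc1, ← hc2, P.inv_op]
    · rintro rfl
      exact (LinearPMap.mem_graph_iff _).mpr ⟨⟨_, P.inv_mem y⟩, rfl, P.op_inv y⟩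
  simp only [hs, ha, ← P.invSqrt_invSqrt]
  exact ⟨fun h => ⟨P.invSqrt y, h, rfl⟩, fun ⟨z, h1, h2⟩ => by rw [h1, h2]⟩

/-- The space `H_{1/2} = D(A^(1/2))`, carrying the inner product
`⟪u, v⟫_{1/2} = ⟪A^(1/2) u, A^(1/2) v⟫`. -/
def Half (P : PosSelfAdjoint H) : Type _ := P.sqrt.domain

namespace Half

variable (P : PosSelfAdjoint H)

instance : AddCommGroup P.Half := inferInstanceAs (AddCommGroup P.sqrt.domain)

instance : Module ℂ P.Half := inferInstanceAs (Module ℂ P.sqrt.domain)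

/-- `A^(1/2)` as a linear map `H_{1/2} → H`. -/
def root : P.Half →ₗ[ℂ] H := P.sqrt.toFun

/-- The inclusion `H_{1/2} ⊆ H` as a linear map. -/
def incl : P.Half →ₗ[ℂ] H := P.sqrt.domain.subtype

theorem invSqrt_root (u : P.Half) : P.invSqrt (root P u) = incl P u := P.invSqrt_sqrt u

theorem root_injective : Function.Injective (root P) := fun u v h => by
  refine Subtype.ext ?_
  change incl P u = incl P v
  rw [← invSqrt_root, ← invSqrt_root, h]

instance innerCore : InnerProductSpace.Core ℂ P.Half where
  inner u v := inner ℂ (root P u) (root P v)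
  conj_inner_symm u v := inner_conj_symm _ _
  re_inner_nonneg u := inner_self_nonneg
  add_left u v w := by rw [map_add, inner_add_left]
  smul_left u v r := by rw [map_smul, inner_smul_left]
  definite u h := root_injective P (by rw [inner_self_eq_zero.mp h, map_zero])

instance : NormedAddCommGroup P.Half := (innerCore P).toNormedAddCommGroup

instance : InnerProductSpace ℂ P.Half := InnerProductSpace.ofCore (innerCore P).toCore

theorem inner_def (u v : P.Half) : inner ℂ u v = inner ℂ (root P u) (root P v) := rfl

theorem norm_eq (u : P.Half) : ‖u‖ = ‖root P u‖ := by
  rw [@norm_eq_sqrt_re_inner ℂ, @norm_eq_sqrt_re_inner ℂ _ _ _ _ (root P u), inner_def]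

/-- `H_{1/2}` is a Hilbert space. -/
instance : CompleteSpace P.Half := by
  let e : P.Half ≃ₗᵢ[ℂ] H :=
    { LinearEquiv.ofBijective (root P)
        ⟨root_injective P, fun y => ⟨⟨P.invSqrt y, P.invSqrt_mem y⟩, P.sqrt_invSqrt y⟩⟩ with
      norm_map' := fun u => (norm_eq P u).symm }
  exact e.toIsometryEquiv.completeSpace

/-- The element of `H_{1/2}` given by an element `x ∈ D(A^(1/2))` of `H`. -/
def ofMem {P : PosSelfAdjoint H} (x : H) (hx : x ∈ P.sqrt.domain) : P.Half := ⟨x, hx⟩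

theorem incl_ofMem {P : PosSelfAdjoint H} (x : H) (hx : x ∈ P.sqrt.domain) :
    incl P (ofMem x hx) = x := rfl

/-- The bounded inclusion `H_{1/2} ⊆ H`. -/
def inclL : P.Half →L[ℂ] H :=
  (incl P).mkContinuous ‖P.invSqrt‖ fun u => by
    rw [norm_eq, ← invSqrt_root]
    exact P.invSqrt.le_opNorm _

end Half

theorem op_domain_le_sqrt_domain (P : PosSelfAdjoint H) : P.op.domain ≤ P.sqrt.domain :=
  fun x hx =>
    ⟨P.invSqrt (P.op ⟨x, hx⟩), (P.invSqrt_invSqrt _).trans (P.inv_op ⟨x, hx⟩)⟩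

/-- The inclusion `H_1 = D(A) ⊆ H_{1/2}`. -/
def opToHalf (P : PosSelfAdjoint H) : P.op.domain →ₗ[ℂ] P.Half where
  toFun x := Half.ofMem x (P.op_domain_le_sqrt_domain x.2)
  map_add' _ _ := rfl
  map_smul' _ _ := rfl

/-- The space `H_{-1/2}`, the (anti)dual of `H_{1/2}`. -/
abbrev NegHalf (P : PosSelfAdjoint H) : Type _ := P.Half →L⋆[ℂ] ℂ

/-- The embedding of the pivot space `H ⊆ H_{-1/2}`: `x ↦ (z ↦ ⟪z, x⟫)`. -/
def pivot (P : PosSelfAdjoint H) (x : H) : P.NegHalf :=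
  ((innerSL ℂ).flip x).comp (Half.inclL P)

theorem pivot_apply (P : PosSelfAdjoint H) (x : H) (z : P.Half) :
    P.pivot x z = inner ℂ (Half.incl P z) x := rfl

end PosSelfAdjoint

open PosSelfAdjoint

/-- The adjoint `B* : H_{1/2} → K` of an operator `B : K → H_{-1/2}`, with respect to the duality
between `H_{-1/2}` and `H_{1/2}`: it is characterized by `⟪B* z, k⟫ = (B k)(z)`. -/
def dualAdjoint {H K : Type*} [NormedAddCommGroup H] [InnerProductSpace ℂ H] [CompleteSpace H]
    [NormedAddCommGroup K] [InnerProductSpace ℂ K] [CompleteSpace K] {P : PosSelfAdjoint H}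
    (B : K →L[ℂ] P.NegHalf) : P.Half →L[ℂ] K :=
  ((InnerProductSpace.toDual ℂ K).symm.toContinuousLinearEquiv :
    StrongDual ℂ K →L⋆[ℂ] K).comp B.flip

theorem inner_dualAdjoint {H K : Type*} [NormedAddCommGroup H] [InnerProductSpace ℂ H]
    [CompleteSpace H] [NormedAddCommGroup K] [InnerProductSpace ℂ K] [CompleteSpace K]
    {P : PosSelfAdjoint H} (B : K →L[ℂ] P.NegHalf) (z : P.Half) (k : K) :
    inner ℂ (dualAdjoint B z) k = B k z :=
  InnerProductSpace.toDual_symm_apply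

/-! ## The space `H^τ` -/

/-- The space `H^τ`: the space `H` with the inner product `⟪u, v⟫_τ = τ ⟪u, v⟫`. -/
def Scaled (_τ : {τ : ℝ // 0 < τ}) (H : Type*) : Type _ := H

namespace Scaled

variable (τ : {τ : ℝ // 0 < τ}) (H : Type*) [NormedAddCommGroup H] [InnerProductSpace ℂ H]

instance : AddCommGroup (Scaled τ H) := inferInstanceAs (AddCommGroup H)

instance : Module ℂ (Scaled τ H) := inferInstanceAs (Module ℂ H)

/-- The identity map `H^τ → H`. -/
def toBase : Scaled τ H ≃ₗ[ℂ] H := LinearEquiv.refl ℂ H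

instance innerCore : InnerProductSpace.Core ℂ (Scaled τ H) where
  inner u v := (τ.1 : ℂ) * inner ℂ (toBase τ H u) (toBase τ H v)
  conj_inner_symm u v := by simp
  re_inner_nonneg u := by
    have h : 0 ≤ (inner ℂ (toBase τ H u) (toBase τ H u)).re := inner_self_nonneg (𝕜 := ℂ)
    have hτ := τ.2
    simpa using mul_nonneg hτ.le h
  add_left u v w := by rw [map_add, inner_add_left, mul_add]
  smul_left u v r := by rw [map_smul, inner_smul_left, mul_left_comm]
  definite u h := by
    have hτ : (τ.1 : ℂ) ≠ 0 := by exact_mod_cast τ.2.ne'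
    have h1 : inner ℂ (toBase τ H u) (toBase τ H u) = 0 := (mul_eq_zero.mp h).resolve_left hτ
    exact (toBase τ H).injective (by rw [inner_self_eq_zero.mp h1, map_zero])

instance : NormedAddCommGroup (Scaled τ H) := (innerCore τ H).toNormedAddCommGroup

instance : InnerProductSpace ℂ (Scaled τ H) := InnerProductSpace.ofCore (innerCore τ H).toCore

theorem inner_def (u v : Scaled τ H) :
    inner ℂ u v = (τ.1 : ℂ) * inner ℂ (toBase τ H u) (toBase τ H v) := rfl

end Scaled

/-! ## The abstract thermo-elastic system -/

/-- The data of the abstract thermo-elastic system. The adjoints `A₂*` and `C*` are not part of the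
data. The assumption that `A₂` restricts to an element of `L(H_{1,1/2}, H₂)` says by duality that
`A₂*` extends to an element of `L(H₂, H_{1,-1/2})`; likewise for `C` and `C*`. The restrictions
`A₂half` and `Chalf` are uniquely determined by `A₂` and `C`. -/
structure ThermoElastic (H₁ H₂ : Type*) [NormedAddCommGroup H₁] [InnerProductSpace ℂ H₁]
    [CompleteSpace H₁] [NormedAddCommGroup H₂] [InnerProductSpace ℂ H₂] [CompleteSpace H₂] where
  /-- the positive self-adjoint operator `A₁` on `H₁` -/
  A₁ : PosSelfAdjoint H₁
  /-- the positive self-adjoint operator `A` on `H₂` -/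
  A : PosSelfAdjoint H₂
  /-- the operator `A₂ ∈ L(H₁, H_{2,-1/2})` -/
  A₂ : H₁ →L[ℂ] A.NegHalf
  /-- the restriction of `A₂` to an operator in `L(H_{1,1/2}, H₂)` -/
  A₂half : A₁.Half →L[ℂ] H₂
  A₂half_eq : ∀ w : A₁.Half, A₂ (Half.incl A₁ w) = A.pivot (A₂half w)
  /-- `A₂* ∈ L(H_{2,1/2}, H₁)` restricts to an operator from `H_{2,1} = D(A)` to `H_{1,1/2}` -/
  A₂star_mem : ∀ v : A.op.domain, dualAdjoint A₂ (A.opToHalf v) ∈ A₁.sqrt.domain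
  /-- `A = A₂ A₂*` on `D(A)` -/
  A_eq : ∀ v : A.op.domain, A₂ (dualAdjoint A₂ (A.opToHalf v)) = A.pivot (A.op v)
  /-- the operator `C ∈ L(H₂, H_{1,-1/2})` -/
  C : H₂ →L[ℂ] A₁.NegHalf
  /-- the restriction of `C` to an operator in `L(H_{2,1/2}, H₁)` -/
  Chalf : A.Half →L[ℂ] H₁
  Chalf_eq : ∀ v : A.Half, C (Half.incl A v) = A₁.pivot (Chalf v)

namespace ThermoElastic

variable {H₁ H₂ : Type*} [NormedAddCommGroup H₁] [InnerProductSpace ℂ H₁] [CompleteSpace H₁]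
  [NormedAddCommGroup H₂] [InnerProductSpace ℂ H₂] [CompleteSpace H₂]

/-- `A₂* ∈ L(H_{2,1/2}, H₁)`. -/
def A₂star (S : ThermoElastic H₁ H₂) : S.A.Half →L[ℂ] H₁ := dualAdjoint S.A₂

/-- `C* ∈ L(H_{1,1/2}, H₂)`. -/
def Cstar (S : ThermoElastic H₁ H₂) : S.A₁.Half →L[ℂ] H₂ := dualAdjoint S.C

/-- The Hilbert space `ℋ = H_{1,1/2} × H₁ × H₂ × H₁^τ`, bracketed as
`(H_{1,1/2} × H₁) × (H₂ × H₁^τ)`, with the sum of the inner products of the factors. -/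
abbrev Space (S : ThermoElastic H₁ H₂) (τ : {τ : ℝ // 0 < τ}) : Type _ :=
  WithLp 2 (WithLp 2 (S.A₁.Half × H₁) × WithLp 2 (H₂ × Scaled τ H₁))

/-- The Hilbert space `ℋ₀ = H_{1,1/2} × H₁ × H₂`, bracketed as `(H_{1,1/2} × H₁) × H₂`. -/
abbrev Space₀ (S : ThermoElastic H₁ H₂) : Type _ :=
  WithLp 2 (WithLp 2 (S.A₁.Half × H₁) × H₂)

/-- The element `(u₁, u₂, v, w)` of `ℋ`. -/
def vec (S : ThermoElastic H₁ H₂) (τ : {τ : ℝ // 0 < τ}) (u₁ : S.A₁.Half) (u₂ : H₁) (v : H₂)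
    (w : H₁) : S.Space τ :=
  WithLp.toLp 2 (WithLp.toLp 2 (u₁, u₂), WithLp.toLp 2 (v, (Scaled.toBase τ H₁).symm w))

/-- The element `(u₁, u₂, v)` of `ℋ₀`. -/
def vec₀ (S : ThermoElastic H₁ H₂) (u₁ : S.A₁.Half) (u₂ : H₁) (v : H₂) : S.Space₀ :=
  WithLp.toLp 2 (WithLp.toLp 2 (u₁, u₂), v)

theorem vec_add (S : ThermoElastic H₁ H₂) (τ : {τ : ℝ // 0 < τ}) (u₁ u₁' : S.A₁.Half)
    (u₂ u₂' : H₁) (v v' : H₂) (w w' : H₁) :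
    S.vec τ (u₁ + u₁') (u₂ + u₂') (v + v') (w + w') =
      S.vec τ u₁ u₂ v w + S.vec τ u₁' u₂' v' w' := rfl

theorem vec_smul (S : ThermoElastic H₁ H₂) (τ : {τ : ℝ // 0 < τ}) (c : ℂ) (u₁ : S.A₁.Half)
    (u₂ : H₁) (v : H₂) (w : H₁) :
    S.vec τ (c • u₁) (c • u₂) (c • v) (c • w) = c • S.vec τ u₁ u₂ v w := rfl

theorem vec₀_add (S : ThermoElastic H₁ H₂) (u₁ u₁' : S.A₁.Half) (u₂ u₂' : H₁) (v v' : H₂) :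
    S.vec₀ (u₁ + u₁') (u₂ + u₂') (v + v') = S.vec₀ u₁ u₂ v + S.vec₀ u₁' u₂' v' := rfl

theorem vec₀_smul (S : ThermoElastic H₁ H₂) (c : ℂ) (u₁ : S.A₁.Half) (u₂ : H₁) (v : H₂) :
    S.vec₀ (c • u₁) (c • u₂) (c • v) = c • S.vec₀ u₁ u₂ v := rfl

theorem inner_vec (S : ThermoElastic H₁ H₂) (τ : {τ : ℝ // 0 < τ}) (u₁ u₁' : S.A₁.Half)
    (u₂ u₂' : H₁) (v v' : H₂) (w w' : H₁) :
    inner ℂ (S.vec τ u₁ u₂ v w) (S.vec τ u₁' u₂' v' w') =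
      inner ℂ (Half.root S.A₁ u₁) (Half.root S.A₁ u₁') + inner ℂ u₂ u₂' + inner ℂ v v'
        + (τ.1 : ℂ) * inner ℂ w w' := by
  simp only [vec, WithLp.prod_inner_apply, Half.inner_def, Scaled.inner_def,
    LinearEquiv.apply_symm_apply]
  ring

theorem inner_vec₀ (S : ThermoElastic H₁ H₂) (u₁ u₁' : S.A₁.Half) (u₂ u₂' : H₁) (v v' : H₂) :
    inner ℂ (S.vec₀ u₁ u₂ v) (S.vec₀ u₁' u₂' v') =
      inner ℂ (Half.root S.A₁ u₁) (Half.root S.A₁ u₁') + inner ℂ u₂ u₂' + inner ℂ v v' := by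
  simp only [vec₀, WithLp.prod_inner_apply, Half.inner_def]

/-- The domain `D(𝒜_d) = H_{1,1} × H_{1,1/2} × H_{2,1/2} × H_{1,1/2}` in `ℋ`. -/
def domainD (S : ThermoElastic H₁ H₂) (τ : {τ : ℝ // 0 < τ}) : Submodule ℂ (S.Space τ) where
  carrier := {W | Half.incl S.A₁ W.fst.fst ∈ S.A₁.op.domain ∧ W.fst.snd ∈ S.A₁.sqrt.domain ∧
    W.snd.fst ∈ S.A.sqrt.domain ∧ Scaled.toBase τ H₁ W.snd.snd ∈ S.A₁.sqrt.domain}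
  add_mem' := fun ⟨a1, a2, a3, a4⟩ ⟨b1, b2, b3, b4⟩ => by
    refine ⟨?_, add_mem a2 b2, add_mem a3 b3, ?_⟩
    · simpa using add_mem a1 b1
    · simpa using add_mem a4 b4
  zero_mem' := by
    refine ⟨?_, zero_mem _, zero_mem _, ?_⟩
    · simp
    · simp
  smul_mem' := fun c _ ⟨a1, a2, a3, a4⟩ => by
    refine ⟨?_, Submodule.smul_mem _ c a2, Submodule.smul_mem _ c a3, ?_⟩
    · simpa using Submodule.smul_mem _ c a1
    · simpa using Submodule.smul_mem _ c a4

/-- The component `u₁ ∈ H_{1,1}` of an element of `D(𝒜_d)`. -/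
def compD₁ (S : ThermoElastic H₁ H₂) (τ : {τ : ℝ // 0 < τ}) :
    S.domainD τ →ₗ[ℂ] S.A₁.op.domain where
  toFun W := ⟨Half.incl S.A₁ W.1.fst.fst, W.2.1⟩
  map_add' _ _ := rfl
  map_smul' _ _ := rfl

/-- The component `u₂ ∈ H_{1,1/2}` of an element of `D(𝒜_d)`. -/
def compD₂ (S : ThermoElastic H₁ H₂) (τ : {τ : ℝ // 0 < τ}) :
    S.domainD τ →ₗ[ℂ] S.A₁.Half where
  toFun W := Half.ofMem W.1.fst.snd W.2.2.1
  map_add' _ _ := rfl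
  map_smul' _ _ := rfl

/-- The component `v ∈ H_{2,1/2}` of an element of `D(𝒜_d)`. -/
def compD₃ (S : ThermoElastic H₁ H₂) (τ : {τ : ℝ // 0 < τ}) :
    S.domainD τ →ₗ[ℂ] S.A.Half where
  toFun W := Half.ofMem W.1.snd.fst W.2.2.2.1
  map_add' _ _ := rfl
  map_smul' _ _ := rfl

/-- The component `w ∈ H_{1,1/2}` of an element of `D(𝒜_d)`. -/
def compD₄ (S : ThermoElastic H₁ H₂) (τ : {τ : ℝ // 0 < τ}) :
    S.domainD τ →ₗ[ℂ] S.A₁.Half where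
  toFun W := Half.ofMem (Scaled.toBase τ H₁ W.1.snd.snd) W.2.2.2.2
  map_add' _ _ := rfl
  map_smul' _ _ := rfl

/-- The operator `𝒜_d (u₁, u₂, v, w) =
(u₂, -A₁ u₁ - C v, C* u₂ - A₂ w, (1/τ) A₂* v - (1/τ) w)` with domain
`H_{1,1} × H_{1,1/2} × H_{2,1/2} × H_{1,1/2}`. -/
def opD (S : ThermoElastic H₁ H₂) (τ : {τ : ℝ // 0 < τ}) : S.Space τ →ₗ.[ℂ] S.Space τ where
  domain := S.domainD τ
  toFun :=
    { toFun := fun W =>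
        S.vec τ (S.compD₂ τ W)
          (-S.A₁.op (S.compD₁ τ W) - S.Chalf (S.compD₃ τ W))
          (S.Cstar (S.compD₂ τ W) - S.A₂half (S.compD₄ τ W))
          ((τ.1 : ℂ)⁻¹ • S.A₂star (S.compD₃ τ W)
            - (τ.1 : ℂ)⁻¹ • Half.incl S.A₁ (S.compD₄ τ W))
      map_add' := fun W W' => by
        simp only [map_add, LinearPMap.map_add, smul_add, ← S.vec_add]
        congr 1 <;> abel
      map_smul' := fun c W => by
        simp only [map_smul, LinearPMap.map_smul, RingHom.id_apply, ← S.vec_smul, smul_sub,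
          smul_neg, smul_comm c] }

/-- The domain `D(𝒜) = H_{1,1} × H_{1,1/2} × H_{2,1}` in `ℋ₀`. -/
def domain₀ (S : ThermoElastic H₁ H₂) : Submodule ℂ S.Space₀ where
  carrier := {W | Half.incl S.A₁ W.fst.fst ∈ S.A₁.op.domain ∧ W.fst.snd ∈ S.A₁.sqrt.domain ∧
    W.snd ∈ S.A.op.domain}
  add_mem' := fun ⟨a1, a2, a3⟩ ⟨b1, b2, b3⟩ => by
    refine ⟨?_, add_mem a2 b2, add_mem a3 b3⟩
    simpa using add_mem a1 b1
  zero_mem' := by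
    refine ⟨?_, zero_mem _, zero_mem _⟩
    simp
  smul_mem' := fun c _ ⟨a1, a2, a3⟩ => by
    refine ⟨?_, Submodule.smul_mem _ c a2, Submodule.smul_mem _ c a3⟩
    simpa using Submodule.smul_mem _ c a1

/-- The component `u₁ ∈ H_{1,1}` of an element of `D(𝒜)`. -/
def comp₁ (S : ThermoElastic H₁ H₂) : S.domain₀ →ₗ[ℂ] S.A₁.op.domain where
  toFun W := ⟨Half.incl S.A₁ W.1.fst.fst, W.2.1⟩
  map_add' _ _ := rfl
  map_smul' _ _ := rfl

/-- The component `u₂ ∈ H_{1,1/2}` of an element of `D(𝒜)`. -/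
def comp₂ (S : ThermoElastic H₁ H₂) : S.domain₀ →ₗ[ℂ] S.A₁.Half where
  toFun W := Half.ofMem W.1.fst.snd W.2.2.1
  map_add' _ _ := rfl
  map_smul' _ _ := rfl

/-- The component `v ∈ H_{2,1}` of an element of `D(𝒜)`. -/
def comp₃ (S : ThermoElastic H₁ H₂) : S.domain₀ →ₗ[ℂ] S.A.op.domain where
  toFun W := ⟨W.1.snd, W.2.2.2⟩
  map_add' _ _ := rfl
  map_smul' _ _ := rfl

/-- The operator `𝒜 (u₁, u₂, v) = (u₂, -A₁ u₁ - C v, C* u₂ - A v)` with domain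
`H_{1,1} × H_{1,1/2} × H_{2,1}`. -/
def op₀ (S : ThermoElastic H₁ H₂) : S.Space₀ →ₗ.[ℂ] S.Space₀ where
  domain := S.domain₀
  toFun :=
    { toFun := fun W =>
        S.vec₀ (S.comp₂ W)
          (-S.A₁.op (S.comp₁ W) - S.Chalf (S.A.opToHalf (S.comp₃ W)))
          (S.Cstar (S.comp₂ W) - S.A.op (S.comp₃ W))
      map_add' := fun W W' => by
        simp only [map_add, LinearPMap.map_add, ← S.vec₀_add]
        congr 1 <;> abel
      map_smul' := fun c W => by
        simp only [map_smul, LinearPMap.map_smul, RingHom.id_apply, ← S.vec₀_smul, smul_sub,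
          smul_neg] }

/-- The natural domain `{w ∈ H₁ : A₂ w ∈ H₂}` of `A₂`, as an unbounded operator from `H₁` to `H₂`,
is `H_{1,1/2}` (which is always contained in it). -/
def A₂DomainEqHalf (S : ThermoElastic H₁ H₂) : Prop :=
  ∀ w : H₁, (∃ f : H₂, S.A₂ w = S.A.pivot f) → w ∈ S.A₁.sqrt.domain

end ThermoElastic

end

/-! On a Hilbert space, a dissipative `B` with `l - B` onto for every `l > 0` generates a
contraction semigroup (Lumer–Phillips, proved here by Yosida approximation). Dissipativity is an
energy identity: the `A₁`, `C` and `A₂` terms cancel against their adjoints, leaving `-Re ⟪A v, v⟫`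
for `𝒜` and `-‖w‖²` for `𝒜_d`.

For the range condition, put `p = A₁^(1/2) u₂` and `q = A^(1/2) v`. The resolvent equation reduces
to a bounded block system with coercive diagonal and skew-adjoint coupling
(`exists_resolvent_solution`).

The delayed case rests on `G = A₂* A^(-1/2)`. The relation `A = A₂ A₂*` says `G* G = 1`
(`adjoint_gradient_gradient`), and `A₂ w = f` means `G* w = A^(-1/2) f`. Eliminating `w` only
rescales the `q` term, so the resolvent equation is always solvable with `w` in the natural domain
of `A₂`, though perhaps not in `H_{1,1/2}`. Projecting with `G G*` shows that such `w` are limits of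
elements of `H_{1,1/2}` with the same value of `A₂` (`mem_closure_of_A₂_eq_pivot`), so these
solutions belong to the closure of `𝒜_d`, which is therefore maximal dissipative. If the natural
domain is `H_{1,1/2}`, the solutions already lie in `D(𝒜_d)`. Conversely a generator is closed,
which forces every `w` of the natural domain into `H_{1,1/2}`. -/

noncomputable section

/-! ### Exponentials of bounded operators -/

section BoundedExponential

variable {X : Type*} [NormedAddCommGroup X] [NormedSpace ℂ X]

theorem norm_exp_smul_le {L : X →L[ℂ] X} (hL : ‖L‖ ≤ 1) {s : ℝ} (hs : 0 ≤ s) :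
    ‖NormedSpace.exp (s • L)‖ ≤ Real.exp s := by
  have hpow : ∀ n : ℕ, ‖L ^ n‖ ≤ 1 := fun n => by
    induction n with
    | zero => rw [pow_zero]; exact ContinuousLinearMap.norm_id_le
    | succ n ih =>
      rw [pow_succ]
      exact (norm_mul_le _ _).trans (mul_le_one₀ ih (norm_nonneg _) hL)
  have hsum : HasSum (fun n : ℕ => s ^ n / n.factorial) (Real.exp s) := by
    rw [Real.exp_eq_exp_ℝ]
    exact NormedSpace.expSeries_div_hasSum_exp s
  rw [NormedSpace.exp_eq_tsum ℝ]
  refine tsum_of_norm_bounded hsum fun n => ?_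
  rw [smul_pow, smul_smul, norm_smul, Real.norm_of_nonneg (by positivity), inv_mul_eq_div]
  exact mul_le_of_le_one_right (by positivity) (hpow n)

variable [CompleteSpace X]

/-- The scalar part commutes with `L` and contributes `e^(-s)`, which absorbs the power series bound
`e^s` for `exp (s L)`. -/
theorem norm_exp_smul_sub_one_le {L : X →L[ℂ] X} (hL : ‖L‖ ≤ 1) {s : ℝ} (hs : 0 ≤ s) :
    ‖NormedSpace.exp (s • (L - 1))‖ ≤ 1 := by
  let := NormedAlgebra.restrictScalars ℚ ℝ (X →L[ℂ] X)
  have h1 : s • (L - 1) = algebraMap ℝ (X →L[ℂ] X) (-s) + s • L := by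
    rw [Algebra.algebraMap_eq_smul_one]; module
  rw [h1, NormedSpace.exp_add_of_commute (Algebra.commutes _ _), ← NormedSpace.algebraMap_exp_comm,
    Algebra.algebraMap_eq_smul_one, smul_mul_assoc, one_mul, norm_smul, ← Real.exp_eq_exp_ℝ,
    Real.norm_of_nonneg (Real.exp_pos _).le, Real.exp_neg, inv_mul_le_one₀ (Real.exp_pos _)]
  exact norm_exp_smul_le hL hs

theorem hasDerivAt_exp_smul_apply (P : X →L[ℂ] X) (x : X) (t : ℝ) :
    HasDerivAt (fun s : ℝ => NormedSpace.exp (s • P) x) (NormedSpace.exp (t • P) (P x)) t := by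
  have h := hasDerivAt_exp_smul_const (𝕂 := ℝ) P t
  exact (((ContinuousLinearMap.apply ℂ X x).restrictScalars ℝ).hasFDerivAt.comp_hasDerivAt t h)

/-- Interpolate by `s ↦ exp (s P) exp ((t - s) Q) x` on `[0, t]`. Since `P` and `Q` commute, its
derivative is `exp (s P) exp ((t - s) Q) (P x - Q x)`, of norm at most `‖P x - Q x‖`. -/
theorem norm_exp_smul_sub_exp_smul_le {P Q : X →L[ℂ] X} (hPQ : Commute P Q)
    (hP : ∀ s : ℝ, 0 ≤ s → ‖NormedSpace.exp (s • P)‖ ≤ 1)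
    (hQ : ∀ s : ℝ, 0 ≤ s → ‖NormedSpace.exp (s • Q)‖ ≤ 1) {t : ℝ} (ht : 0 ≤ t) (x : X) :
    ‖NormedSpace.exp (t • P) x - NormedSpace.exp (t • Q) x‖ ≤ t * ‖P x - Q x‖ := by
  let := NormedAlgebra.restrictScalars ℚ ℝ (X →L[ℂ] X)
  have hd : ∀ s : ℝ,
      HasDerivAt (fun s : ℝ => (NormedSpace.exp (s • P) * NormedSpace.exp ((t - s) • Q)) x)
      ((NormedSpace.exp (s • P) * NormedSpace.exp ((t - s) • Q)) (P x - Q x)) s := by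
    intro s
    have h1 := hasDerivAt_exp_smul_const (𝕂 := ℝ) P s
    have h2 : HasDerivAt (fun s : ℝ => NormedSpace.exp ((t - s) • Q))
        (-(NormedSpace.exp ((t - s) • Q) * Q)) s := by
      have := (hasDerivAt_exp_smul_const (𝕂 := ℝ) Q (t - s)).scomp s
        ((hasDerivAt_id s).const_sub t)
      rwa [neg_one_smul] at this
    have h3 : HasDerivAt
        (fun s : ℝ => (NormedSpace.exp (s • P) * NormedSpace.exp ((t - s) • Q)) x)
        ((NormedSpace.exp (s • P) * P * NormedSpace.exp ((t - s) • Q)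
          + NormedSpace.exp (s • P) * -(NormedSpace.exp ((t - s) • Q) * Q)) x) s :=
      ((ContinuousLinearMap.apply ℂ X x).restrictScalars ℝ).hasFDerivAt.comp_hasDerivAt s
        (h1.mul h2)
    have hc : Commute P (NormedSpace.exp ((t - s) • Q)) :=
      (hPQ.smul_right _).exp_right
    have h4 : NormedSpace.exp (s • P) * P * NormedSpace.exp ((t - s) • Q)
          + NormedSpace.exp (s • P) * -(NormedSpace.exp ((t - s) • Q) * Q)
        = NormedSpace.exp (s • P) * NormedSpace.exp ((t - s) • Q) * (P - Q) := by
      rw [mul_assoc, hc.eq]; noncomm_ring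
    rw [h4] at h3
    exact h3
  have h := norm_image_sub_le_of_norm_deriv_le_segment' (a := 0) (b := t)
    (C := ‖P x - Q x‖) (fun s _ => (hd s).hasDerivWithinAt) (fun s hs => by
      refine ((NormedSpace.exp (s • P) * NormedSpace.exp ((t - s) • Q)).le_opNorm _).trans ?_
      refine mul_le_of_le_one_left (norm_nonneg _) ((norm_mul_le _ _).trans ?_)
      exact mul_le_one₀ (hP s hs.1) (norm_nonneg _) (hQ _ (sub_nonneg.2 hs.2.le)))
    t ⟨ht, le_rfl⟩
  simpa [mul_comm] using h

end BoundedExponential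

/-! ### Closedness of generators -/

section Generators

variable {X : Type*} [NormedAddCommGroup X] [NormedSpace ℂ X]

theorem NNReal.tendsto_sub_toNNReal_nhdsGT (t : ℝ) :
    Tendsto (fun s : ℝ => (s - t).toNNReal) (𝓝[>] t) (𝓝[>] 0) := by
  refine tendsto_nhdsWithin_iff.2 ⟨?_, ?_⟩
  · refine tendsto_nhdsWithin_of_tendsto_nhds ?_
    have : Continuous fun s : ℝ => (s - t).toNNReal := by fun_prop
    simpa using this.tendsto t
  · filter_upwards [self_mem_nhdsWithin] with s hs
    exact Real.toNNReal_pos.2 (sub_pos.2 hs)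

theorem ContractionSemigroup.norm_apply_le (S : ContractionSemigroup X) (t : ℝ≥0) (x : X) :
    ‖S.T t x‖ ≤ ‖x‖ :=
  ((S.T t).le_opNorm x).trans (mul_le_of_le_one_left (norm_nonneg _) (S.contraction t))

/-- By the semigroup law, the right difference quotient at `t` is `T t` applied to the one at `0`.
-/
theorem ContractionSemigroup.IsGenerator.hasDerivWithinAt {S : ContractionSemigroup X}
    {B : X →ₗ.[ℂ] X} (hB : S.IsGenerator B) {x y : X} (hxy : (x, y) ∈ B.graph) {t : ℝ}
    (ht : 0 ≤ t) :
    HasDerivWithinAt (fun s : ℝ => S.T s.toNNReal x) (S.T t.toNNReal y) (Set.Ici t) t := by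
  rw [← hasDerivWithinAt_Ioi_iff_Ici, hasDerivWithinAt_iff_tendsto_slope' Set.self_notMem_Ioi]
  have h1 := ((S.T t.toNNReal).continuous.tendsto y).comp
    (((hB x y).1 hxy).comp (NNReal.tendsto_sub_toNNReal_nhdsGT t))
  refine h1.congr' ?_
  filter_upwards [self_mem_nhdsWithin] with s hs
  have hs' : t < s := hs
  have h2 : s.toNNReal = t.toNNReal + (s - t).toNNReal := by
    rw [← Real.toNNReal_add ht (sub_nonneg.2 hs'.le), add_sub_cancel]
  rw [slope_def_module, h2, S.map_add]
  simp only [Function.comp_apply, map_smul, map_sub, ContinuousLinearMap.comp_apply,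
    Real.coe_toNNReal _ (sub_nonneg.2 hs'.le)]
  rw [← Complex.ofReal_inv, Complex.coe_smul]

/-- Mean value inequality for `s ↦ T s x - s y`, whose right derivative is `T s y - y`. It replaces
the integral formula for `T h x - x`, and unlike the difference quotient it passes to limits in `(x,
y)`. -/
theorem ContractionSemigroup.IsGenerator.norm_sub_sub_smul_le {S : ContractionSemigroup X}
    {B : X →ₗ.[ℂ] X} (hB : S.IsGenerator B) {x y : X} (hxy : (x, y) ∈ B.graph) {h : ℝ≥0} {C : ℝ}
    (hC : ∀ s ≤ h, ‖S.T s y - y‖ ≤ C) :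
    ‖S.T h x - x - (h : ℂ) • y‖ ≤ C * h := by
  have hd : ∀ s : ℝ, 0 ≤ s → HasDerivWithinAt (fun s : ℝ => S.T s.toNNReal x - s • y)
      (S.T s.toNNReal y - y) (Set.Ici s) s := fun s hs => by
    have := (hB.hasDerivWithinAt hxy hs).sub
      ((hasDerivWithinAt_id s (Set.Ici s)).smul_const y)
    rwa [one_smul] at this
  have hc : Continuous fun s : ℝ => S.T s.toNNReal x - s • y :=
    ((S.strongly_continuous x).comp continuous_real_toNNReal).sub
      (continuous_id.smul continuous_const)
  have h1 := norm_image_sub_le_of_norm_deriv_right_le_segment (a := 0) (b := (h : ℝ)) (C := C)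
    hc.continuousOn (fun s hs => hd s hs.1)
    (fun s hs => hC _ (Real.toNNReal_le_iff_le_coe.2 hs.2.le)) h ⟨h.2, le_rfl⟩
  have h2 : ((h : ℂ)) • y = (h : ℝ) • y := Complex.coe_smul (h : ℝ) y
  rw [h2, sub_right_comm]
  simpa [S.map_zero] using h1

/-- The generator of a contraction semigroup is a closed operator. -/
theorem GeneratesContractionSemigroup.isClosed {B : X →ₗ.[ℂ] X}
    (hB : GeneratesContractionSemigroup B) : B.IsClosed := by
  obtain ⟨S, hS⟩ := hB
  refine IsSeqClosed.isClosed fun z z₀ hz hlim => ?_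
  have hx : Tendsto (fun n => (z n).1) atTop (𝓝 z₀.1) := (continuous_fst.tendsto z₀).comp hlim
  have hy : Tendsto (fun n => (z n).2) atTop (𝓝 z₀.2) := (continuous_snd.tendsto z₀).comp hlim
  -- The estimate survives the limit: replacing `z₀.2` by `(z n).2` costs at most `2 ‖(z n).2 -
  -- z₀.2‖` in the constant.
  have key : ∀ (h : ℝ≥0) (C : ℝ), (∀ s ≤ h, ‖S.T s z₀.2 - z₀.2‖ ≤ C) →
      ‖S.T h z₀.1 - z₀.1 - (h : ℂ) • z₀.2‖ ≤ C * h := by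
    intro h C hC
    have h1 : ∀ n, ‖S.T h (z n).1 - (z n).1 - (h : ℂ) • (z n).2‖
        ≤ (C + 2 * ‖(z n).2 - z₀.2‖) * h := fun n => by
      refine hS.norm_sub_sub_smul_le (hz n) fun s hs => ?_
      have h3 : S.T s (z n).2 - (z n).2
          = (S.T s z₀.2 - z₀.2) + (S.T s ((z n).2 - z₀.2) - ((z n).2 - z₀.2)) := by
        rw [map_sub]; abel
      rw [h3]
      refine (norm_add_le _ _).trans (add_le_add (hC s hs) ((norm_sub_le _ _).trans ?_))
      linarith [S.norm_apply_le s ((z n).2 - z₀.2)]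
    have h4 : Tendsto (fun n => ‖S.T h (z n).1 - (z n).1 - (h : ℂ) • (z n).2‖) atTop
        (𝓝 ‖S.T h z₀.1 - z₀.1 - (h : ℂ) • z₀.2‖) :=
      (((((S.T h).continuous.tendsto _).comp hx).sub hx).sub (hy.const_smul _)).norm
    have h5 : Tendsto (fun n => (C + 2 * ‖(z n).2 - z₀.2‖) * (h : ℝ)) atTop
        (𝓝 ((C + 2 * ‖z₀.2 - z₀.2‖) * h)) :=
      ((((hy.sub_const _).norm).const_mul 2).const_add C).mul_const _
    have h6 := le_of_tendsto_of_tendsto' h4 h5 h1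
    simpa using h6
  -- Strong continuity at `0` allows `C = ε / 2` for small `h`; dividing the estimate by `h` gives
  -- the difference quotient.
  refine (hS z₀.1 z₀.2).2 (Metric.tendsto_nhds.2 fun ε hε => ?_)
  have hcont := Metric.tendsto_nhds.1 ((S.strongly_continuous z₀.2).tendsto 0) (ε / 2) (half_pos hε)
  simp only [S.map_zero, ContinuousLinearMap.id_apply] at hcont
  obtain ⟨δ, hδ, hδ'⟩ := Metric.eventually_nhds_iff.1 hcont
  have hmem : Set.Iio δ.toNNReal ∈ 𝓝[>] (0 : ℝ≥0) :=
    mem_nhdsWithin_of_mem_nhds (Iio_mem_nhds (Real.toNNReal_pos.2 hδ))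
  filter_upwards [self_mem_nhdsWithin, hmem] with h hpos hlt
  have hpos' : (0 : ℝ) < h := NNReal.coe_pos.2 hpos
  have hlt' : (h : ℝ) < δ := Real.lt_toNNReal_iff_coe_lt.1 hlt
  have h1 := key h (ε / 2) fun s hs => by
    rw [← dist_eq_norm]
    refine (hδ' ?_).le
    rw [NNReal.dist_eq, NNReal.coe_zero, sub_zero, abs_of_nonneg s.coe_nonneg]
    exact (NNReal.coe_le_coe.2 hs).trans_lt hlt'
  have h0 : ((h : ℝ) : ℂ) ≠ 0 := by exact_mod_cast hpos'.ne'
  have h2 : ((h : ℝ)⁻¹ : ℂ) • (S.T h z₀.1 - z₀.1) - z₀.2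
      = ((h : ℝ)⁻¹ : ℂ) • (S.T h z₀.1 - z₀.1 - (h : ℂ) • z₀.2) := by
    rw [smul_sub _ _ ((h : ℂ) • z₀.2), smul_smul, inv_mul_cancel₀ h0, one_smul]
  rw [dist_eq_norm, h2, norm_smul, norm_inv, Complex.norm_real, Real.norm_of_nonneg hpos'.le,
    inv_mul_lt_iff₀ hpos']
  nlinarith

end Generators

/-! ### The Lumer–Phillips theorem -/

section LumerPhillips

variable {X : Type*} [NormedAddCommGroup X] [InnerProductSpace ℂ X]

/-- The operator `B` on a Hilbert space is dissipative. -/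
def LinearPMap.IsDissipative (B : X →ₗ.[ℂ] X) : Prop :=
  ∀ x : B.domain, (inner ℂ (B x) (x : X)).re ≤ 0

theorem LinearPMap.IsDissipative.re_inner_le {B : X →ₗ.[ℂ] X} (hB : B.IsDissipative) {x y : X}
    (hxy : (x, y) ∈ B.graph) : (inner ℂ y x).re ≤ 0 := by
  obtain ⟨z, hz1, hz2⟩ := (LinearPMap.mem_graph_iff _).1 hxy
  simp only at hz1 hz2
  rw [← hz1, ← hz2]
  exact hB z

/-- Dissipativity gives `l ‖x‖² ≤ Re ⟪l x - B x, x⟫`; apply Cauchy–Schwarz. -/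
theorem LinearPMap.IsDissipative.norm_le {B : X →ₗ.[ℂ] X} (hB : B.IsDissipative) {l : ℝ}
    (hl : 0 < l) (x : B.domain) : ‖(x : X)‖ ≤ l⁻¹ * ‖(l : ℂ) • (x : X) - B x‖ := by
  have h1 : (inner ℂ ((l : ℂ) • (x : X) - B x) (x : X)).re
      = l * ‖(x : X)‖ ^ 2 - (inner ℂ (B x) (x : X)).re := by
    rw [inner_sub_left, inner_smul_left, inner_self_eq_norm_sq_to_K]
    simp [← Complex.ofReal_pow]
  have h2 : (inner ℂ ((l : ℂ) • (x : X) - B x) (x : X)).re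
      ≤ ‖(l : ℂ) • (x : X) - B x‖ * ‖(x : X)‖ :=
    (Complex.re_le_norm _).trans (norm_inner_le_norm _ _)
  have h3 := hB x
  rw [inv_mul_eq_div, le_div_iff₀' hl]
  rcases eq_or_lt_of_le (norm_nonneg (x : X)) with h0 | h0
  · rw [← h0]; simp
  · nlinarith

/-- `B` is maximal dissipative: it is dissipative and `l - B` is surjective for all `l > 0`. -/
structure LinearPMap.IsMaxDissipative (B : X →ₗ.[ℂ] X) : Prop where
  dissipative : B.IsDissipative
  surjective : ∀ l : ℝ, 0 < l → ∀ y : X, ∃ x : B.domain, (l : ℂ) • (x : X) - B x = y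

namespace LinearPMap.IsMaxDissipative

variable {B : X →ₗ.[ℂ] X}

theorem resolvent_bijective (hB : B.IsMaxDissipative) {l : ℝ} (hl : 0 < l) :
    Function.Bijective ((l : ℂ) • B.domain.subtype - B.toFun) := by
  refine ⟨(injective_iff_map_eq_zero _).2 fun x hx => ?_, fun y => hB.surjective l hl y⟩
  have h1 := hB.dissipative.norm_le hl x
  have h2 : (l : ℂ) • (x : X) - B x = 0 := hx
  rw [h2, norm_zero, mul_zero] at h1
  exact Subtype.ext (norm_le_zero_iff.1 h1)

/-- The resolvent `(l - B)⁻¹`. -/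
def resolvent (hB : B.IsMaxDissipative) {l : ℝ} (hl : 0 < l) : X →ₗ[ℂ] X :=
  B.domain.subtype ∘ₗ (LinearEquiv.ofBijective _ (hB.resolvent_bijective hl)).symm.toLinearMap

theorem resolvent_mem_graph (hB : B.IsMaxDissipative) {l : ℝ} (hl : 0 < l) (y : X) :
    (hB.resolvent hl y, (l : ℂ) • hB.resolvent hl y - y) ∈ B.graph := by
  let x := (LinearEquiv.ofBijective _ (hB.resolvent_bijective hl)).symm y
  have hx : (l : ℂ) • (x : X) - B x = y :=
    (LinearEquiv.ofBijective _ (hB.resolvent_bijective hl)).apply_symm_apply y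
  refine (LinearPMap.mem_graph_iff _).2 ⟨x, rfl, ?_⟩
  change B x = (l : ℂ) • (x : X) - y
  rw [← hx, sub_sub_cancel]

theorem resolvent_smul_sub (hB : B.IsMaxDissipative) {l : ℝ} (hl : 0 < l) {x z : X}
    (hxz : (x, z) ∈ B.graph) : hB.resolvent hl ((l : ℂ) • x - z) = x := by
  obtain ⟨w, hw1, hw2⟩ := (LinearPMap.mem_graph_iff _).1 hxz
  simp only at hw1 hw2
  rw [← hw1, ← hw2]
  exact congrArg Subtype.val
    ((LinearEquiv.ofBijective _ (hB.resolvent_bijective hl)).symm_apply_apply w)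

theorem resolvent_map_mem_graph (hB : B.IsMaxDissipative) {l : ℝ} (hl : 0 < l) {x z : X}
    (hxz : (x, z) ∈ B.graph) : (hB.resolvent hl x, hB.resolvent hl z) ∈ B.graph := by
  have h1 := hB.resolvent_smul_sub hl hxz
  rw [_root_.map_sub, _root_.map_smul, sub_eq_iff_eq_add, ← sub_eq_iff_eq_add'] at h1
  rw [← h1]
  exact hB.resolvent_mem_graph hl x

/-- The resolvent at `m` preserves the graph of `B`, so `l - B` sends `R_m R_l y` to `R_m y`; apply
`R_l`. -/
theorem resolvent_comm (hB : B.IsMaxDissipative) {l m : ℝ} (hl : 0 < l) (hm : 0 < m) (y : X) :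
    hB.resolvent hl (hB.resolvent hm y) = hB.resolvent hm (hB.resolvent hl y) := by
  have h1 := hB.resolvent_smul_sub hl (hB.resolvent_map_mem_graph hm (hB.resolvent_mem_graph hl y))
  rwa [← _root_.map_smul, ← _root_.map_sub, sub_sub_cancel] at h1

theorem norm_resolvent_le (hB : B.IsMaxDissipative) {l : ℝ} (hl : 0 < l) (y : X) :
    l * ‖hB.resolvent hl y‖ ≤ ‖y‖ := by
  obtain ⟨x, hx1, hx2⟩ := (LinearPMap.mem_graph_iff _).1 (hB.resolvent_mem_graph hl y)
  simp only at hx1 hx2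
  have h := hB.dissipative.norm_le hl x
  rwa [hx2, hx1, sub_sub_cancel, inv_mul_eq_div, le_div_iff₀' hl] at h

/-- The operators `(n + 1) (n + 1 - B)⁻¹`, which converge strongly to the identity. -/
def regularizer (hB : B.IsMaxDissipative) (n : ℕ) : X →L[ℂ] X :=
  (((n + 1 : ℝ) : ℂ) • hB.resolvent n.cast_add_one_pos).mkContinuous 1 fun y => by
    have h := hB.norm_resolvent_le (Nat.cast_add_one_pos (α := ℝ) n) y
    rw [one_mul, LinearMap.smul_apply, norm_smul, Complex.norm_real,
      Real.norm_of_nonneg (by positivity)]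
    exact h

theorem regularizer_apply (hB : B.IsMaxDissipative) (n : ℕ) (y : X) :
    hB.regularizer n y = ((n + 1 : ℝ) : ℂ) • hB.resolvent n.cast_add_one_pos y := rfl

theorem norm_regularizer_le (hB : B.IsMaxDissipative) (n : ℕ) : ‖hB.regularizer n‖ ≤ 1 :=
  LinearMap.mkContinuous_norm_le _ zero_le_one _

theorem commute_regularizer (hB : B.IsMaxDissipative) (n m : ℕ) :
    Commute (hB.regularizer n) (hB.regularizer m) := by
  refine ContinuousLinearMap.ext fun y => ?_
  change hB.regularizer n (hB.regularizer m y) = hB.regularizer m (hB.regularizer n y)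
  rw [regularizer_apply, regularizer_apply, regularizer_apply, regularizer_apply, _root_.map_smul,
    _root_.map_smul, resolvent_comm, smul_comm]

/-- The Yosida approximations of `B`. -/
def yosida (hB : B.IsMaxDissipative) (n : ℕ) : X →L[ℂ] X := (n + 1 : ℝ) • (hB.regularizer n - 1)

/-- With `l = n + 1`, the identity `l R_l x - x = R_l z` holds on the graph. Strong convergence of
the regularizers thus becomes convergence of the Yosida approximations to `B`. -/
theorem yosida_apply (hB : B.IsMaxDissipative) (n : ℕ) {x z : X} (hxz : (x, z) ∈ B.graph) :
    hB.yosida n x = hB.regularizer n z := by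
  have h := hB.resolvent_smul_sub (Nat.cast_add_one_pos (α := ℝ) n) hxz
  rw [_root_.map_sub, _root_.map_smul, sub_eq_iff_eq_add] at h
  change (n + 1 : ℝ) • (hB.regularizer n x - x) = _
  rw [regularizer_apply, regularizer_apply, h, add_sub_cancel_left, ← Complex.coe_smul]

theorem commute_yosida (hB : B.IsMaxDissipative) (n m : ℕ) :
    Commute (hB.yosida n) (hB.yosida m) :=
  ((((hB.commute_regularizer n m).sub_left (Commute.one_left _)).sub_right
    (Commute.one_right _)).smul_right _).smul_left _

theorem regularizer_sub (hB : B.IsMaxDissipative) (n : ℕ) {x z : X} (hxz : (x, z) ∈ B.graph) :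
    ‖hB.regularizer n x - x‖ ≤ ‖z‖ / (n + 1 : ℝ) := by
  have hn : (0 : ℝ) < n + 1 := n.cast_add_one_pos
  rw [le_div_iff₀' hn]
  calc (n + 1 : ℝ) * ‖hB.regularizer n x - x‖ = ‖hB.yosida n x‖ := by
        change _ = ‖(n + 1 : ℝ) • (hB.regularizer n x - x)‖
        rw [norm_smul, Real.norm_of_nonneg hn.le]
    _ ≤ ‖z‖ := by
        rw [hB.yosida_apply n hxz]
        exact ((hB.regularizer n).le_opNorm z).trans
          (mul_le_of_le_one_left (norm_nonneg _) (hB.norm_regularizer_le n))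

/-- Write a vector orthogonal to the domain as `x - B x`. Pairing with `x` gives `‖x‖² = Re ⟪B x, x⟫
≤ 0`. -/
theorem dense_domain [CompleteSpace X] (hB : B.IsMaxDissipative) : Dense (B.domain : Set X) := by
  rw [Submodule.dense_iff_topologicalClosure_eq_top, Submodule.topologicalClosure_eq_top_iff,
    Submodule.eq_bot_iff]
  intro y hy
  obtain ⟨x, rfl⟩ := hB.surjective 1 one_pos y
  have h1 := (Submodule.mem_orthogonal' _ _).1 hy x x.2
  have h2 := hB.dissipative x
  rw [inner_sub_left, sub_eq_zero, Complex.ofReal_one, one_smul] at h1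
  rw [← h1, inner_self_eq_norm_sq_to_K] at h2
  have h3 : ‖(x : X)‖ ^ 2 ≤ 0 := by simpa [← Complex.ofReal_pow] using h2
  have h4 : x = 0 := Subtype.ext (norm_eq_zero.1 (by nlinarith [norm_nonneg (x : X)]))
  rw [h4]; simp

/-- On the domain the error is `O(1 / (n + 1))`. A family of contractions is equicontinuous, so the
set of points of convergence is closed. -/
theorem tendsto_regularizer [CompleteSpace X] (hB : B.IsMaxDissipative) (x : X) :
    Tendsto (fun n => hB.regularizer n x) atTop (𝓝 x) := by
  have hlip : ∀ n, LipschitzWith 1 (hB.regularizer n) := fun n =>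
    (hB.regularizer n).lipschitz.weaken (hB.norm_regularizer_le n)
  refine hB.dense_domain.induction (P := fun x => Tendsto (fun n => hB.regularizer n x) atTop (𝓝 x))
    (fun x hx => ?_) ((LipschitzWith.uniformEquicontinuous _ 1
      hlip).equicontinuous.isClosed_setOfPred_tendsto continuous_id) x
  rw [tendsto_iff_norm_sub_tendsto_zero]
  refine squeeze_zero (fun _ => norm_nonneg _)
    (fun n => hB.regularizer_sub n (B.mem_graph ⟨x, hx⟩)) ?_
  simpa [div_eq_mul_inv] using
    (tendsto_one_div_add_atTop_nhds_zero_nat (𝕜 := ℝ)).const_mul ‖B ⟨x, hx⟩‖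

theorem tendsto_yosida [CompleteSpace X] (hB : B.IsMaxDissipative) {x z : X}
    (hxz : (x, z) ∈ B.graph) : Tendsto (fun n => hB.yosida n x) atTop (𝓝 z) := by
  simpa only [hB.yosida_apply _ hxz] using hB.tendsto_regularizer z

theorem norm_exp_yosida_le [CompleteSpace X] (hB : B.IsMaxDissipative) (n : ℕ) {t : ℝ}
    (ht : 0 ≤ t) : ‖NormedSpace.exp (t • hB.yosida n)‖ ≤ 1 := by
  rw [yosida, smul_smul]
  exact norm_exp_smul_sub_one_le (hB.norm_regularizer_le n) (by positivity)

theorem norm_exp_yosida_apply_le [CompleteSpace X] (hB : B.IsMaxDissipative) (n : ℕ) {t : ℝ}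
    (ht : 0 ≤ t) (x : X) : ‖NormedSpace.exp (t • hB.yosida n) x‖ ≤ ‖x‖ :=
  (ContinuousLinearMap.le_opNorm _ x).trans
    (mul_le_of_le_one_left (norm_nonneg _) (hB.norm_exp_yosida_le n ht))

theorem norm_exp_yosida_sub_le [CompleteSpace X] (hB : B.IsMaxDissipative) (n m : ℕ) {t : ℝ}
    (ht : 0 ≤ t) (x : X) :
    ‖NormedSpace.exp (t • hB.yosida n) x - NormedSpace.exp (t • hB.yosida m) x‖
      ≤ t * ‖hB.yosida n x - hB.yosida m x‖ :=
  norm_exp_smul_sub_exp_smul_le (hB.commute_yosida n m) (fun _ => hB.norm_exp_yosida_le n)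
    (fun _ => hB.norm_exp_yosida_le m) ht x

theorem cauchySeq_exp_yosida [CompleteSpace X] (hB : B.IsMaxDissipative) {t : ℝ} (ht : 0 ≤ t)
    (x : X) : CauchySeq fun n => NormedSpace.exp (t • hB.yosida n) x := by
  refine Metric.cauchySeq_iff.2 fun ε hε => ?_
  obtain ⟨z, hz, hzD⟩ := Metric.dense_iff.1 hB.dense_domain x (ε / 3) (by positivity)
  have hzx : ‖x - z‖ < ε / 3 := by rw [← dist_eq_norm, dist_comm]; exact hz
  have hcau := (hB.tendsto_yosida (B.mem_graph ⟨z, hzD⟩)).cauchySeq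
  -- Dividing by `t + 1` rather than `t` covers `t = 0`.
  obtain ⟨N, hN⟩ := Metric.cauchySeq_iff.1 hcau (ε / 3 / (t + 1)) (by positivity)
  refine ⟨N, fun n hn m hm => ?_⟩
  have h1 := hB.norm_exp_yosida_apply_le n ht (x - z)
  have h2 := hB.norm_exp_yosida_apply_le m ht (x - z)
  have h3 := hB.norm_exp_yosida_sub_le n m ht z
  have h4 := hN n hn m hm
  rw [dist_eq_norm, lt_div_iff₀ (by positivity)] at h4
  simp only at h4
  have h5 : NormedSpace.exp (t • hB.yosida n) x - NormedSpace.exp (t • hB.yosida m) x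
      = NormedSpace.exp (t • hB.yosida n) (x - z) - NormedSpace.exp (t • hB.yosida m) (x - z)
        + (NormedSpace.exp (t • hB.yosida n) z - NormedSpace.exp (t • hB.yosida m) z) := by
    rw [_root_.map_sub, _root_.map_sub]; abel
  rw [dist_eq_norm, h5]
  refine (norm_add_le _ _).trans_lt ((add_le_add_left (norm_sub_le _ _) _).trans_lt ?_)
  nlinarith [norm_nonneg (hB.yosida n z - hB.yosida m z)]

theorem exists_tendsto_exp_yosida [CompleteSpace X] (hB : B.IsMaxDissipative) (t : ℝ≥0) :
    ∃ T : X →L[ℂ] X, ∀ x,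
      Tendsto (fun n => NormedSpace.exp ((t : ℝ) • hB.yosida n) x) atTop (𝓝 (T x)) := by
  choose f hf using fun x => cauchySeq_tendsto_of_complete (hB.cauchySeq_exp_yosida t.coe_nonneg x)
  exact ⟨continuousLinearMapOfTendsto _ (tendsto_pi_nhds.2 hf), hf⟩

/-- The limit of the semigroups generated by the Yosida approximations of `B`. -/
def semigroupMap [CompleteSpace X] (hB : B.IsMaxDissipative) (t : ℝ≥0) : X →L[ℂ] X :=
  (hB.exists_tendsto_exp_yosida t).choose

theorem tendsto_exp_yosida [CompleteSpace X] (hB : B.IsMaxDissipative) (t : ℝ≥0) (x : X) :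
    Tendsto (fun n => NormedSpace.exp ((t : ℝ) • hB.yosida n) x) atTop
      (𝓝 (hB.semigroupMap t x)) :=
  (hB.exists_tendsto_exp_yosida t).choose_spec x

theorem norm_semigroupMap_apply_le [CompleteSpace X] (hB : B.IsMaxDissipative) (t : ℝ≥0) (x : X) :
    ‖hB.semigroupMap t x‖ ≤ ‖x‖ :=
  le_of_tendsto' (hB.tendsto_exp_yosida t x).norm
    fun n => hB.norm_exp_yosida_apply_le n t.coe_nonneg x

theorem semigroupMap_zero [CompleteSpace X] (hB : B.IsMaxDissipative) :
    hB.semigroupMap 0 = ContinuousLinearMap.id ℂ X := by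
  refine ContinuousLinearMap.ext fun x => tendsto_nhds_unique (hB.tendsto_exp_yosida 0 x) ?_
  simp

theorem semigroupMap_add [CompleteSpace X] (hB : B.IsMaxDissipative) (s t : ℝ≥0) :
    hB.semigroupMap (s + t) = (hB.semigroupMap s).comp (hB.semigroupMap t) := by
  let := NormedAlgebra.restrictScalars ℚ ℝ (X →L[ℂ] X)
  refine ContinuousLinearMap.ext fun x => tendsto_nhds_unique (hB.tendsto_exp_yosida (s + t) x) ?_
  -- Isolate the error of the inner limit; the outer exponential is a contraction and cannot enlarge
  -- it.
  have h1 : ∀ n, NormedSpace.exp (((s + t : ℝ≥0) : ℝ) • hB.yosida n) x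
      = NormedSpace.exp ((s : ℝ) • hB.yosida n) (hB.semigroupMap t x)
        + NormedSpace.exp ((s : ℝ) • hB.yosida n)
          (NormedSpace.exp ((t : ℝ) • hB.yosida n) x - hB.semigroupMap t x) := fun n => by
    rw [← _root_.map_add, add_sub_cancel, NNReal.coe_add, add_smul,
      NormedSpace.exp_add_of_commute (((Commute.refl _).smul_right _).smul_left _)]
    rfl
  simp only [h1]
  have h2 : Tendsto (fun n => NormedSpace.exp ((s : ℝ) • hB.yosida n)
      (NormedSpace.exp ((t : ℝ) • hB.yosida n) x - hB.semigroupMap t x)) atTop (𝓝 0) :=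
    squeeze_zero_norm (fun n => hB.norm_exp_yosida_apply_le n s.coe_nonneg _)
      (tendsto_iff_norm_sub_tendsto_zero.1 (hB.tendsto_exp_yosida t x))
  simpa using (hB.tendsto_exp_yosida s (hB.semigroupMap t x)).add h2

theorem norm_semigroupMap_sub_exp_le [CompleteSpace X] (hB : B.IsMaxDissipative) (t : ℝ≥0) (n : ℕ)
    {x z : X} (hxz : (x, z) ∈ B.graph) :
    ‖hB.semigroupMap t x - NormedSpace.exp ((t : ℝ) • hB.yosida n) x‖
      ≤ t * ‖z - hB.yosida n x‖ :=
  le_of_tendsto_of_tendsto' ((hB.tendsto_exp_yosida t x).sub_const _).norm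
    (((hB.tendsto_yosida hxz).sub_const _).norm.const_mul _)
    fun m => hB.norm_exp_yosida_sub_le m n t.coe_nonneg x

theorem norm_semigroupMap_sub_le [CompleteSpace X] (hB : B.IsMaxDissipative) (t : ℝ≥0)
    {x z : X} (hxz : (x, z) ∈ B.graph) : ‖hB.semigroupMap t x - x‖ ≤ t * ‖z‖ := by
  refine le_of_tendsto_of_tendsto' ((hB.tendsto_exp_yosida t x).sub_const _).norm
    ((hB.tendsto_yosida hxz).norm.const_mul _) fun n => ?_
  -- Compare with the zero operator, whose exponential is the identity.
  have := norm_exp_smul_sub_exp_smul_le (Commute.zero_right (hB.yosida n))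
    (fun _ => hB.norm_exp_yosida_le n)
    (fun s _ => by
      rw [smul_zero, NormedSpace.exp_zero]; exact ContinuousLinearMap.norm_id_le) t.coe_nonneg x
  simpa using this

theorem lipschitzWith_semigroupMap [CompleteSpace X] (hB : B.IsMaxDissipative)
    {x z : X} (hxz : (x, z) ∈ B.graph) :
    LipschitzWith ‖z‖₊ fun t => hB.semigroupMap t x := by
  have key : ∀ s t : ℝ≥0, s ≤ t →
      dist (hB.semigroupMap s x) (hB.semigroupMap t x) ≤ ‖z‖ * dist s t := fun s t hst => by
    obtain ⟨r, rfl⟩ := exists_add_of_le hst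
    have h1 : dist s (s + r) = r := by rw [NNReal.dist_eq]; simp
    rw [h1, dist_comm, dist_eq_norm, semigroupMap_add, ContinuousLinearMap.comp_apply,
      ← _root_.map_sub, mul_comm]
    exact (hB.norm_semigroupMap_apply_le s _).trans (hB.norm_semigroupMap_sub_le r hxz)
  refine LipschitzWith.of_dist_le_mul fun s t => ?_
  rcases le_total s t with h | h
  · exact key s t h
  · rw [dist_comm, dist_comm s]; exact key t s h

theorem continuous_semigroupMap [CompleteSpace X] (hB : B.IsMaxDissipative) (x : X) :
    Continuous fun t => hB.semigroupMap t x := by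
  have hlip : ∀ t, LipschitzWith 1 (hB.semigroupMap t) := fun t =>
    LipschitzWith.of_dist_le_mul fun y z => by
      rw [dist_eq_norm, dist_eq_norm, ← _root_.map_sub, NNReal.coe_one, one_mul]
      exact hB.norm_semigroupMap_apply_le t _
  refine continuous_iff_continuousAt.2 fun t => ?_
  refine hB.dense_domain.induction
    (P := fun x => Tendsto (fun s => hB.semigroupMap s x) (𝓝 t) (𝓝 (hB.semigroupMap t x)))
    (fun x hx => ?_) ((LipschitzWith.uniformEquicontinuous _ 1
      hlip).equicontinuous.isClosed_setOfPred_tendsto (hB.semigroupMap t).continuous) x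
  exact (hB.lipschitzWith_semigroupMap (B.mem_graph ⟨x, hx⟩)).continuous.tendsto t

/-- The contraction semigroup generated by a maximal dissipative operator. -/
def semigroup [CompleteSpace X] (hB : B.IsMaxDissipative) : ContractionSemigroup X where
  T := hB.semigroupMap
  map_zero := hB.semigroupMap_zero
  map_add := hB.semigroupMap_add
  strongly_continuous := hB.continuous_semigroupMap
  contraction t := ContinuousLinearMap.opNorm_le_bound _ zero_le_one fun x => by
    rw [one_mul]; exact hB.norm_semigroupMap_apply_le t x

/-- Fix `n` with `B_n x` close to `z`. Replacing the semigroup by `exp (h B_n)` changes the quotient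
by at most `‖z - B_n x‖`, uniformly in `h`, and the exponential is differentiable at `0`. -/
theorem tendsto_differenceQuotient [CompleteSpace X] (hB : B.IsMaxDissipative) {x z : X}
    (hxz : (x, z) ∈ B.graph) :
    Tendsto (fun h : ℝ≥0 => ((h : ℝ)⁻¹ : ℂ) • (hB.semigroupMap h x - x)) (𝓝[>] 0) (𝓝 z) := by
  refine Metric.tendsto_nhds.2 fun ε hε => ?_
  obtain ⟨n, hn⟩ := (Metric.tendsto_nhds.1 (hB.tendsto_yosida hxz) (ε / 3) (by positivity)).exists
  have hd : Tendsto (fun h : ℝ≥0 => (h : ℝ)⁻¹ • (NormedSpace.exp ((h : ℝ) • hB.yosida n) x - x))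
      (𝓝[>] 0) (𝓝 (hB.yosida n x)) := by
    have h1 := (hasDerivAt_exp_smul_apply (hB.yosida n) x 0).tendsto_slope_zero_right
    have h2 : Tendsto (fun h : ℝ≥0 => (h : ℝ)) (𝓝[>] 0) (𝓝[>] 0) :=
      tendsto_nhdsWithin_iff.2 ⟨tendsto_nhdsWithin_of_tendsto_nhds
        (NNReal.continuous_coe.tendsto 0), by
          filter_upwards [self_mem_nhdsWithin] with h hh using NNReal.coe_pos.2 hh⟩
    have h3 := h1.comp h2
    simp only [zero_add, zero_smul, NormedSpace.exp_zero] at h3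
    exact h3
  filter_upwards [Metric.tendsto_nhds.1 hd (ε / 3) (by positivity), self_mem_nhdsWithin]
    with h h1 hpos
  have hpos' : (0 : ℝ) < h := NNReal.coe_pos.2 hpos
  have h2 := hB.norm_semigroupMap_sub_exp_le h n hxz
  rw [← inv_mul_le_iff₀ hpos', ← Real.norm_of_nonneg (inv_nonneg.2 hpos'.le), ← norm_smul] at h2
  rw [dist_eq_norm] at hn h1 ⊢
  rw [← Complex.ofReal_inv, Complex.coe_smul]
  have h3 : (h : ℝ)⁻¹ • (hB.semigroupMap h x - x) - z
      = (h : ℝ)⁻¹ • (hB.semigroupMap h x - NormedSpace.exp ((h : ℝ) • hB.yosida n) x)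
        + ((h : ℝ)⁻¹ • (NormedSpace.exp ((h : ℝ) • hB.yosida n) x - x) - hB.yosida n x)
        + (hB.yosida n x - z) := by
    module
  rw [h3]
  refine norm_add₃_le.trans_lt ?_
  rw [norm_sub_rev z] at h2
  linarith

/-- The Lumer–Phillips theorem: a maximal dissipative operator on a Hilbert space generates a
contraction semigroup. -/
theorem generatesContractionSemigroup [CompleteSpace X] (hB : B.IsMaxDissipative) :
    GeneratesContractionSemigroup B := by
  refine ⟨hB.semigroup, fun x y => ⟨hB.tendsto_differenceQuotient, fun h => ?_⟩⟩
  -- The generator cannot be larger than `B`: with `z - B z = x - y`, the difference `d = x - z` has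
  -- derivative `y - B z = d` at `0`. Contractivity gives `Re ⟪T h d - d, d⟫ ≤ 0`, whence `‖d‖² ≤
  -- 0`.
  obtain ⟨z, hz⟩ := hB.surjective 1 one_pos (x - y)
  rw [Complex.ofReal_one, one_smul] at hz
  have hBz : y - B z = x - z := by rw [← sub_sub_self (z : X) (B z), hz]; abel
  have h1 := h.sub (hB.tendsto_differenceQuotient (B.mem_graph z))
  have h2 : Tendsto (fun h : ℝ≥0 => (inner ℂ (((h : ℝ)⁻¹ : ℂ) • (hB.semigroupMap h (x - z)
      - (x - z))) (x - z : X)).re) (𝓝[>] 0) (𝓝 (inner ℂ (x - z : X) (x - z : X)).re) := by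
    refine (Complex.continuous_re.tendsto _).comp (Tendsto.inner ?_ tendsto_const_nhds)
    rw [hBz] at h1
    refine h1.congr fun h => ?_
    rw [_root_.map_sub, ← smul_sub]
    congr 1
    change hB.semigroupMap h x - x - (hB.semigroupMap h z - z) = _
    abel
  have h3 : (inner ℂ (x - z : X) (x - z : X)).re ≤ 0 := by
    refine le_of_tendsto h2 (Eventually.of_forall fun h => ?_)
    rw [inner_smul_left, inner_sub_left, ← Complex.ofReal_inv, Complex.conj_ofReal,
      Complex.re_ofReal_mul, Complex.sub_re]
    refine mul_nonpos_of_nonneg_of_nonpos (by positivity) (sub_nonpos.2 ?_)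
    have h4 : (inner ℂ (hB.semigroupMap h (x - z)) (x - z : X)).re
        ≤ ‖hB.semigroupMap h (x - z)‖ * ‖(x - z : X)‖ :=
      (Complex.re_le_norm _).trans (norm_inner_le_norm _ _)
    have h5 : (inner ℂ (x - z : X) (x - z : X)).re = ‖(x - z : X)‖ * ‖(x - z : X)‖ :=
      inner_self_eq_norm_mul_norm (𝕜 := ℂ) _
    rw [h5]
    exact h4.trans (mul_le_mul_of_nonneg_right (hB.norm_semigroupMap_apply_le h _)
      (norm_nonneg _))
  have h6 : x - z = 0 := by
    have h5 : (inner ℂ (x - z : X) (x - z : X)).re = ‖(x - z : X)‖ * ‖(x - z : X)‖ :=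
      inner_self_eq_norm_mul_norm (𝕜 := ℂ) _
    rw [h5] at h3
    exact norm_eq_zero.1 (by nlinarith [norm_nonneg (x - z : X)])
  rw [h6] at hBz
  rw [sub_eq_zero.1 h6, sub_eq_zero.1 hBz]
  exact B.mem_graph z

end LinearPMap.IsMaxDissipative

namespace LinearPMap.IsDissipative

variable {B : X →ₗ.[ℂ] X}

theorem re_inner_nonpos_of_mem_topologicalClosure (hB : B.IsDissipative) {p : X × X}
    (hp : p ∈ B.graph.topologicalClosure) : (inner ℂ p.2 p.1).re ≤ 0 := by
  have hcl : _root_.IsClosed {p : X × X | (inner ℂ p.2 p.1).re ≤ 0} :=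
    isClosed_le (Complex.continuous_re.comp (continuous_snd.inner continuous_fst)) continuous_const
  exact closure_minimal (fun p hp => hB.re_inner_le hp) hcl hp

/-- If `(0, y)` is in the closure of the graph, so is `(s z, y + s B z)`. Dividing the dissipation
inequality by `s` and letting `s ↓ 0` gives `Re ⟪y, z⟫ ≤ 0` for `z` in the domain, hence by density
for `z = y`. -/
theorem isClosable (hB : B.IsDissipative) (hD : Dense (B.domain : Set X)) : B.IsClosable := by
  refine ⟨_, (Submodule.toLinearPMap_graph_eq B.graph.topologicalClosure ?_).symm⟩
  rintro ⟨x, y⟩ hxy hx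
  obtain rfl : x = 0 := hx
  have key : ∀ z : X, (inner ℂ y z).re ≤ 0 := by
    refine hD.induction (fun z hz => ?_)
      (isClosed_le (Complex.continuous_re.comp (continuous_const.inner continuous_id))
        continuous_const)
    have h1 : ∀ s : ℝ, 0 < s →
        s * (inner ℂ (B ⟨z, hz⟩) z).re + (inner ℂ y z).re ≤ 0 := fun s hs => by
      have h2 := hB.re_inner_nonpos_of_mem_topologicalClosure (add_mem hxy
        (B.graph.le_topologicalClosure (B.graph.smul_mem (s : ℂ) (B.mem_graph ⟨z, hz⟩))))
      simp only [Prod.smul_mk, Prod.mk_add_mk, zero_add, inner_add_left, inner_smul_left,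
        inner_smul_right, Complex.conj_ofReal, Complex.add_re, Complex.re_ofReal_mul] at h2
      nlinarith
    have h3 : Tendsto (fun s : ℝ => s * (inner ℂ (B ⟨z, hz⟩) z).re + (inner ℂ y z).re) (𝓝[>] 0)
        (𝓝 (inner ℂ y z).re) := by
      refine tendsto_nhdsWithin_of_tendsto_nhds ?_
      have : Continuous fun s : ℝ => s * (inner ℂ (B ⟨z, hz⟩) z).re + (inner ℂ y z).re := by
        fun_prop
      simpa using this.tendsto 0
    exact le_of_tendsto h3 (by filter_upwards [self_mem_nhdsWithin] with s hs using h1 s hs)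
  have h5 : (inner ℂ y y).re = ‖y‖ * ‖y‖ := inner_self_eq_norm_mul_norm (𝕜 := ℂ) _
  have h6 := key y
  rw [h5] at h6
  exact norm_eq_zero.1 (by nlinarith [norm_nonneg y])

theorem closure (hB : B.IsDissipative) (hc : B.IsClosable) : B.closure.IsDissipative := by
  intro x
  have hx := B.closure.mem_graph x
  rw [← hc.graph_closure_eq_closure_graph] at hx
  exact hB.re_inner_nonpos_of_mem_topologicalClosure hx

end LinearPMap.IsDissipative

end LumerPhillips

/-! ### Coercive operators and skew-coupled block systems -/

section Coercive

variable {E F : Type*} [NormedAddCommGroup E] [InnerProductSpace ℂ E] [CompleteSpace E]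
  [NormedAddCommGroup F] [InnerProductSpace ℂ F] [CompleteSpace F]

theorem ContinuousLinearMap.surjective_of_coercive (T : E →L[ℂ] E) {c : ℝ} (hc : 0 < c)
    (h : ∀ x, c * ‖x‖ ^ 2 ≤ (inner ℂ (T x) x).re) : Function.Surjective T := by
  have hu : IsUnit T := ContinuousLinearMap.isUnit_of_forall_le_norm_inner_map T (c := ⟨c, hc.le⟩) hc fun x => by
    rw [mul_comm]
    exact (h x).trans (Complex.re_le_norm _)
  exact (ContinuousLinearMap.isUnit_iff_bijective.1 hu).2

/-- Eliminate `q = Q⁻¹ (k + M* p)`. The Schur complement `P + M Q⁻¹ M*` is as coercive as `P`,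
because `Re ⟪Q⁻¹ y, y⟫ = Re ⟪Q Q⁻¹ y, Q⁻¹ y⟫ ≥ 0`. -/
theorem exists_solution_of_coercive (P : E →L[ℂ] E) (Q : F →L[ℂ] F) (M : F →L[ℂ] E) {a b : ℝ}
    (ha : 0 < a) (hb : 0 < b) (hP : ∀ x, a * ‖x‖ ^ 2 ≤ (inner ℂ (P x) x).re)
    (hQ : ∀ x, b * ‖x‖ ^ 2 ≤ (inner ℂ (Q x) x).re) (g : E) (k : F) :
    ∃ (p : E) (q : F), P p + M q = g ∧ Q q - M.adjoint p = k := by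
  have hQu : IsUnit Q := ContinuousLinearMap.isUnit_of_forall_le_norm_inner_map Q (c := ⟨b, hb.le⟩) hb fun x => by
    rw [mul_comm]
    exact (hQ x).trans (Complex.re_le_norm _)
  obtain ⟨⟨Q, R, hQR, hRQ⟩, rfl⟩ := hQu
  have hQR' : ∀ x, Q (R x) = x := fun x => congrArg (fun T : F →L[ℂ] F => T x) hQR
  obtain ⟨p, hp⟩ := ContinuousLinearMap.surjective_of_coercive
    (P + M.comp (R.comp M.adjoint)) ha (fun x => by
      have h1 : inner ℂ (M (R (M.adjoint x))) x = inner ℂ (R (M.adjoint x)) (M.adjoint x) :=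
        (ContinuousLinearMap.adjoint_inner_right M _ _).symm
      have h2 := hQ (R (M.adjoint x))
      change _ ≤ (inner ℂ (Q (R (M.adjoint x))) (R (M.adjoint x))).re at h2
      rw [hQR', ← inner_conj_symm, Complex.conj_re] at h2
      change _ ≤ (inner ℂ (P x + M (R (M.adjoint x))) x).re
      rw [inner_add_left, h1, Complex.add_re]
      have h3 : 0 ≤ b * ‖R (M.adjoint x)‖ ^ 2 := by positivity
      linarith [hP x]) (g - M (R k))
  refine ⟨p, R (k + M.adjoint p), ?_, ?_⟩
  · change P p + M (R (M.adjoint p)) = _ at hp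
    rw [map_add, map_add, add_left_comm, hp, add_sub_cancel]
  · change Q (R (k + M.adjoint p)) - _ = _
    rw [hQR', add_sub_cancel_right]

end Coercive

/-! ### Calculus of `A^(-1/2)` and the spaces `H_{1/2}`, `H_{-1/2}` -/

namespace PosSelfAdjoint

variable {H : Type*} [NormedAddCommGroup H] [InnerProductSpace ℂ H] [CompleteSpace H]

theorem inner_invSqrt_left (P : PosSelfAdjoint H) (x y : H) :
    inner ℂ (P.invSqrt x) y = inner ℂ x (P.invSqrt y) :=
  ContinuousLinearMap.isSelfAdjoint_iff_isSymmetric.1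
    (IsSelfAdjoint.of_nonneg (CFC.sqrt_nonneg P.inv)) x y

theorem eq_zero_of_forall_inner_invSqrt (P : PosSelfAdjoint H) {x : H}
    (h : ∀ y, inner ℂ (P.invSqrt y) x = 0) : x = 0 := by
  refine P.invSqrt_injective ?_
  rw [map_zero, ← inner_self_eq_zero (𝕜 := ℂ), ← inner_invSqrt_left]
  exact h _

theorem dense_sqrt_domain (P : PosSelfAdjoint H) : Dense (P.sqrt.domain : Set H) := by
  rw [Submodule.dense_iff_topologicalClosure_eq_top, Submodule.topologicalClosure_eq_top_iff,
    Submodule.eq_bot_iff]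
  exact fun y hy => P.eq_zero_of_forall_inner_invSqrt fun x =>
    (Submodule.mem_orthogonal _ _).1 hy _ (P.invSqrt_mem x)

/-- The isometry `A^(-1/2) : H → H_{1/2}`. -/
def toHalf (P : PosSelfAdjoint H) : H →L[ℂ] P.Half :=
  LinearMap.mkContinuous
    { toFun := fun x => Half.ofMem (P.invSqrt x) (P.invSqrt_mem x)
      map_add' := fun x y => Subtype.ext (map_add P.invSqrt x y)
      map_smul' := fun c x => Subtype.ext (map_smul P.invSqrt c x) } 1 fun x => by
    rw [one_mul, Half.norm_eq]
    exact (congrArg norm (P.sqrt_invSqrt x)).le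

theorem incl_toHalf (P : PosSelfAdjoint H) (x : H) : Half.incl P (P.toHalf x) = P.invSqrt x := rfl

theorem root_toHalf (P : PosSelfAdjoint H) (x : H) : Half.root P (P.toHalf x) = x :=
  P.sqrt_invSqrt x

theorem incl_injective (P : PosSelfAdjoint H) : Function.Injective (Half.incl P) :=
  Subtype.val_injective

theorem toHalf_root (P : PosSelfAdjoint H) (u : P.Half) : P.toHalf (Half.root P u) = u :=
  P.incl_injective (Half.invSqrt_root P u)

theorem toHalf_invSqrt (P : PosSelfAdjoint H) (y : H) :
    P.toHalf (P.invSqrt y) = P.opToHalf ⟨P.inv y, P.inv_mem y⟩ :=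
  P.incl_injective (P.invSqrt_invSqrt y)

theorem root_opToHalf (P : PosSelfAdjoint H) (x : P.op.domain) :
    Half.root P (P.opToHalf x) = P.invSqrt (P.op x) := by
  refine P.invSqrt_injective ?_
  rw [Half.invSqrt_root, invSqrt_invSqrt, inv_op]
  rfl

theorem pivot_injective (P : PosSelfAdjoint H) : Function.Injective P.pivot := fun x y h => by
  refine sub_eq_zero.1 (P.eq_zero_of_forall_inner_invSqrt fun z => ?_)
  have h1 := congrArg (fun T : P.NegHalf => T (P.toHalf z)) h
  simp only [pivot_apply, incl_toHalf] at h1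
  rw [inner_sub_right, h1, sub_self]

theorem negHalf_ext (P : PosSelfAdjoint H) {f g : P.NegHalf}
    (h : ∀ x, f (P.toHalf x) = g (P.toHalf x)) : f = g :=
  ContinuousLinearMap.ext fun u => by rw [← P.toHalf_root u]; exact h _

theorem coercive_invSqrt (P : PosSelfAdjoint H) {l : ℝ} (hl : 0 ≤ l) (c : ℝ) (x : H) :
    c * ‖x‖ ^ 2 ≤
      (inner ℂ (((l : ℂ) • P.invSqrt.comp P.invSqrt + (c : ℂ) • 1 : H →L[ℂ] H) x) x).re := by
  change _ ≤ (inner ℂ ((l : ℂ) • P.invSqrt (P.invSqrt x) + (c : ℂ) • x) x).re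
  have h : ∀ y : H, (inner ℂ y y).re = ‖y‖ ^ 2 := fun y => by
    rw [sq]; exact inner_self_eq_norm_mul_norm (𝕜 := ℂ) y
  rw [inner_add_left, inner_smul_left, inner_smul_left, inner_invSqrt_left, Complex.conj_ofReal,
    Complex.conj_ofReal, Complex.add_re, Complex.re_ofReal_mul, Complex.re_ofReal_mul, h, h]
  nlinarith [mul_nonneg hl (sq_nonneg ‖P.invSqrt x‖)]

end PosSelfAdjoint

open PosSelfAdjoint

/-! ### Reduction of the system to bounded operators -/

namespace ThermoElastic

variable {H₁ H₂ : Type*} [NormedAddCommGroup H₁] [InnerProductSpace ℂ H₁] [CompleteSpace H₁]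
  [NormedAddCommGroup H₂] [InnerProductSpace ℂ H₂] [CompleteSpace H₂]

/-- `C A^(-1/2)` as a bounded operator from `H₂` to `H₁`. -/
def coupling (S : ThermoElastic H₁ H₂) : H₂ →L[ℂ] H₁ := S.Chalf.comp S.A.toHalf

/-- `A₂* A^(-1/2)` as a bounded operator from `H₂` to `H₁`. -/
def gradient (S : ThermoElastic H₁ H₂) : H₂ →L[ℂ] H₁ := S.A₂star.comp S.A.toHalf

theorem inner_A₂star (S : ThermoElastic H₁ H₂) (v : S.A.Half) (w : H₁) :
    inner ℂ (S.A₂star v) w = S.A₂ w v := inner_dualAdjoint S.A₂ v w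

theorem inner_Cstar (S : ThermoElastic H₁ H₂) (u : S.A₁.Half) (v : H₂) :
    inner ℂ (S.Cstar u) v = S.C v u := inner_dualAdjoint S.C u v

theorem inner_Cstar_incl (S : ThermoElastic H₁ H₂) (u : S.A₁.Half) (v : S.A.Half) :
    inner ℂ (S.Cstar u) (Half.incl S.A v) = inner ℂ (Half.incl S.A₁ u) (S.Chalf v) := by
  rw [inner_Cstar, S.Chalf_eq, pivot_apply]

theorem inner_A₂star_incl (S : ThermoElastic H₁ H₂) (v : S.A.Half) (w : S.A₁.Half) :
    inner ℂ (S.A₂star v) (Half.incl S.A₁ w) = inner ℂ (Half.incl S.A v) (S.A₂half w) := by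
  rw [inner_A₂star, S.A₂half_eq, pivot_apply]

/-- This makes the two coupling terms of the reduced system adjoint to each other. -/
theorem invSqrt_Cstar_toHalf (S : ThermoElastic H₁ H₂) (p : H₁) :
    S.A.invSqrt (S.Cstar (S.A₁.toHalf p)) = S.coupling.adjoint (S.A₁.invSqrt p) := by
  refine ext_inner_right ℂ fun q => ?_
  rw [inner_invSqrt_left, ContinuousLinearMap.adjoint_inner_left]
  exact S.inner_Cstar_incl (S.A₁.toHalf p) (S.A.toHalf q)

/-- `A₂ w = f ∈ H₂`, expressed through bounded operators. -/
theorem A₂_eq_pivot_iff (S : ThermoElastic H₁ H₂) (w : H₁) (f : H₂) :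
    S.A₂ w = S.A.pivot f ↔ S.gradient.adjoint w = S.A.invSqrt f := by
  have h1 : ∀ q, S.A₂ w (S.A.toHalf q) = inner ℂ q (S.gradient.adjoint w) := fun q => by
    rw [ContinuousLinearMap.adjoint_inner_right, ← inner_A₂star]
    rfl
  have h2 : ∀ q, S.A.pivot f (S.A.toHalf q) = inner ℂ q (S.A.invSqrt f) := fun q => by
    rw [pivot_apply, incl_toHalf, inner_invSqrt_left]
  constructor
  · intro h
    refine ext_inner_left ℂ fun q => ?_
    rw [← h1, ← h2, h]
  · intro h
    refine S.A.negHalf_ext fun q => ?_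
    rw [h1, h2, h]

theorem gradient_invSqrt (S : ThermoElastic H₁ H₂) (y : H₂) :
    S.gradient (S.A.invSqrt y) = S.A₂star (S.A.opToHalf ⟨S.A.inv y, S.A.inv_mem y⟩) :=
  congrArg S.A₂star (S.A.toHalf_invSqrt y)

theorem gradient_invSqrt_mem (S : ThermoElastic H₁ H₂) (y : H₂) :
    S.gradient (S.A.invSqrt y) ∈ S.A₁.sqrt.domain := by
  rw [gradient_invSqrt]
  exact S.A₂star_mem _

/-- For `q = A^(-1/2) y` this is `A₂ A₂* A⁻¹ y = y`, tested against the range of `A^(-1/2)`; such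
`q` are dense. So `G` is an isometry and `G G*` an orthogonal projection. -/
theorem adjoint_gradient_gradient (S : ThermoElastic H₁ H₂) (q : H₂) :
    S.gradient.adjoint (S.gradient q) = q := by
  refine S.A.dense_sqrt_domain.induction (P := fun q => S.gradient.adjoint (S.gradient q) = q) ?_
    (isClosed_eq (S.gradient.adjoint.continuous.comp S.gradient.continuous) continuous_id) q
  rintro _ ⟨y, rfl⟩
  change S.gradient.adjoint (S.gradient (S.A.invSqrt y)) = S.A.invSqrt y
  rw [← A₂_eq_pivot_iff, gradient_invSqrt]
  exact (S.A_eq _).trans (by rw [op_inv])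

/-- `{w ∈ H_{1,1/2} : A₂ w = f}` is dense in `{w ∈ H₁ : A₂ w = f}`. -/
theorem mem_closure_of_A₂_eq_pivot (S : ThermoElastic H₁ H₂) {w : H₁} {f : H₂}
    (h : S.A₂ w = S.A.pivot f) :
    w ∈ closure {z : H₁ | ∃ u : S.A₁.Half, Half.incl S.A₁ u = z ∧ S.A₂half u = f} := by
  rw [A₂_eq_pivot_iff] at h
  -- The map is the projection onto the affine space `G* z = A^(-1/2) f`; it is continuous and fixes
  -- `w`. It preserves `H_{1,1/2}`, because there `G* z = A^(-1/2) A₂ z` and `G A^(-1/2) = A₂* A⁻¹`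
  -- takes values in `H_{1,1/2}`.
  have h1 := map_mem_closure
    (f := fun z => z - S.gradient (S.gradient.adjoint z) + S.gradient (S.A.invSqrt f))
    (t := {z : H₁ | ∃ u : S.A₁.Half, Half.incl S.A₁ u = z ∧ S.A₂half u = f})
    (by fun_prop) (S.A₁.dense_sqrt_domain w) fun z hz => by
      have hz' : S.gradient.adjoint z = S.A.invSqrt (S.A₂half (Half.ofMem z hz)) := by
        rw [← A₂_eq_pivot_iff]
        exact S.A₂half_eq (Half.ofMem z hz)
      have hmem : z - S.gradient (S.gradient.adjoint z) + S.gradient (S.A.invSqrt f)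
          ∈ S.A₁.sqrt.domain := by
        rw [hz']
        exact add_mem (sub_mem hz (S.gradient_invSqrt_mem _)) (S.gradient_invSqrt_mem _)
      refine ⟨Half.ofMem _ hmem, rfl, S.A.pivot_injective ?_⟩
      rw [← S.A₂half_eq, A₂_eq_pivot_iff, Half.incl_ofMem, map_add, map_sub,
        adjoint_gradient_gradient, adjoint_gradient_gradient, sub_self, zero_add]
  simpa only [h, sub_add_cancel] using h1

/-- Eliminate `u₁` and apply `A₁^(-1/2)` to the second equation: the diagonal blocks become `l A₁⁻¹
+ l⁻¹` and `l A⁻¹ + k`, with skew-adjoint coupling. The third equation is already multiplied by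
`A^(-1/2)`. The parameter `k` serves both operators: `k = 1` for `𝒜` and `k = 1 / (1 + l τ)` for
`𝒜_d`. -/
theorem exists_resolvent_solution (S : ThermoElastic H₁ H₂) {l k : ℝ} (hl : 0 < l) (hk : 0 < k)
    (f₁ : S.A₁.Half) (f₂ : H₁) (g : H₂) :
    ∃ (u₁ : S.A₁.op.domain) (p : H₁) (q : H₂),
      (l : ℂ) • S.A₁.opToHalf u₁ - S.A₁.toHalf p = f₁ ∧
      (l : ℂ) • S.A₁.invSqrt p + S.A₁.op u₁ + S.Chalf (S.A.toHalf q) = f₂ ∧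
      (l : ℂ) • S.A.invSqrt (S.A.invSqrt q) - S.A.invSqrt (S.Cstar (S.A₁.toHalf p))
        + (k : ℂ) • q = g := by
  have hl0 : (l : ℂ) ≠ 0 := by exact_mod_cast hl.ne'
  obtain ⟨p, q, hp, hq⟩ := exists_solution_of_coercive
    ((l : ℂ) • S.A₁.invSqrt.comp S.A₁.invSqrt + ((l⁻¹ : ℝ) : ℂ) • 1)
    ((l : ℂ) • S.A.invSqrt.comp S.A.invSqrt + (k : ℂ) • 1)
    (S.A₁.invSqrt.comp S.coupling) (inv_pos.2 hl) hk
    (S.A₁.coercive_invSqrt hl.le _) (S.A.coercive_invSqrt hl.le _)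
    (S.A₁.invSqrt f₂ - (l : ℂ)⁻¹ • Half.root S.A₁ f₁) g
  have hadj : (S.A₁.invSqrt.comp S.coupling).adjoint p
      = S.A.invSqrt (S.Cstar (S.A₁.toHalf p)) := by
    rw [invSqrt_Cstar_toHalf]
    refine ext_inner_right ℂ fun x => ?_
    rw [ContinuousLinearMap.adjoint_inner_left, ContinuousLinearMap.adjoint_inner_left,
      inner_invSqrt_left]
    rfl
  rw [hadj] at hq
  change (l : ℂ) • S.A₁.invSqrt (S.A₁.invSqrt p) + ((l⁻¹ : ℝ) : ℂ) • p
    + S.A₁.invSqrt (S.Chalf (S.A.toHalf q)) = _ at hp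
  change (l : ℂ) • S.A.invSqrt (S.A.invSqrt q) + (k : ℂ) • q - _ = _ at hq
  -- The value that the second equation prescribes for `A₁ u₁`; the block equation for `p` then
  -- yields the first equation.
  set y : H₁ := f₂ - (l : ℂ) • S.A₁.invSqrt p - S.Chalf (S.A.toHalf q) with hy
  refine ⟨⟨S.A₁.inv y, S.A₁.inv_mem y⟩, p, q, ?_, ?_, ?_⟩
  · have h1 : S.A₁.invSqrt y = (l : ℂ)⁻¹ • (p + Half.root S.A₁ f₁) := by
      rw [hy, map_sub, map_sub, map_smul]
      rw [Complex.ofReal_inv] at hp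
      rw [smul_add]
      linear_combination (norm := module) (-1 : ℂ) • hp
    refine Half.root_injective S.A₁ ?_
    rw [map_sub, map_smul, root_opToHalf, op_inv, root_toHalf, h1, smul_inv_smul₀ hl0,
      add_sub_cancel_left]
  · rw [op_inv, hy]; abel
  · rw [← hq]; abel

end ThermoElastic

/-! ### Completeness of `H^τ` -/

namespace Scaled

variable (τ : {τ : ℝ // 0 < τ}) (H : Type*) [NormedAddCommGroup H] [InnerProductSpace ℂ H]

theorem norm_eq (u : Scaled τ H) : ‖u‖ = √τ.1 * ‖toBase τ H u‖ := by
  have h : (inner ℂ (toBase τ H u) (toBase τ H u)).re = ‖toBase τ H u‖ ^ 2 := by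
    rw [sq]; exact inner_self_eq_norm_mul_norm (𝕜 := ℂ) _
  rw [@norm_eq_sqrt_re_inner ℂ, inner_def, RCLike.re_to_complex, Complex.re_ofReal_mul, h,
    Real.sqrt_mul τ.2.le, Real.sqrt_sq (norm_nonneg _)]

instance [CompleteSpace H] : CompleteSpace (Scaled τ H) := by
  have hτ : ((√τ.1 : ℝ) : ℂ) ≠ 0 := by exact_mod_cast (Real.sqrt_pos.2 τ.2).ne'
  let e : Scaled τ H ≃ₗᵢ[ℂ] H :=
    { (toBase τ H).trans (LinearEquiv.smulOfNeZero ℂ H _ hτ) with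
      norm_map' := fun u => by
        rw [norm_eq]
        change ‖((√τ.1 : ℝ) : ℂ) • toBase τ H u‖ = _
        rw [norm_smul, Complex.norm_real, Real.norm_of_nonneg (Real.sqrt_nonneg _)] }
  exact e.toIsometryEquiv.completeSpace

end Scaled

/-! ### Energy identity and the operator `𝒜` -/

namespace ThermoElastic

variable {H₁ H₂ : Type*} [NormedAddCommGroup H₁] [InnerProductSpace ℂ H₁] [CompleteSpace H₁]
  [NormedAddCommGroup H₂] [InnerProductSpace ℂ H₂] [CompleteSpace H₂]

/-- The conservative part common to both systems: the elastic terms cancel because the inner product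
of `H_{1,1/2}` is the form of `A₁`, and `C` cancels against `C*`. -/
theorem re_inner_op (S : ThermoElastic H₁ H₂) (u₁ : S.A₁.op.domain) (u₂ : S.A₁.Half) (v : S.A.Half) :
    (inner ℂ (Half.root S.A₁ u₂) (Half.root S.A₁ (S.A₁.opToHalf u₁))
      + inner ℂ (-S.A₁.op u₁ - S.Chalf v) (Half.incl S.A₁ u₂)
      + inner ℂ (S.Cstar u₂) (Half.incl S.A v)).re = 0 := by
  rw [root_opToHalf, ← inner_invSqrt_left, Half.invSqrt_root, inner_Cstar_incl, inner_sub_left,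
    inner_neg_left, ← inner_conj_symm (S.A₁.op u₁), ← inner_conj_symm (S.Chalf v)]
  simp only [Complex.add_re, Complex.sub_re, Complex.neg_re, Complex.conj_re]
  ring

theorem mem_graph_op₀ (S : ThermoElastic H₁ H₂) (u₁ : S.A₁.op.domain) (u₂ : S.A₁.Half)
    (v : S.A.op.domain) :
    (S.vec₀ (S.A₁.opToHalf u₁) (Half.incl S.A₁ u₂) v,
      S.vec₀ u₂ (-S.A₁.op u₁ - S.Chalf (S.A.opToHalf v)) (S.Cstar u₂ - S.A.op v))
        ∈ S.op₀.graph :=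
  (LinearPMap.mem_graph_iff _).2
    ⟨⟨S.vec₀ (S.A₁.opToHalf u₁) (Half.incl S.A₁ u₂) v, u₁.2, u₂.2, v.2⟩, rfl, rfl⟩

theorem isDissipative_op₀ (S : ThermoElastic H₁ H₂) : S.op₀.IsDissipative := by
  intro W
  change (inner ℂ (S.vec₀ (S.comp₂ W)
    (-S.A₁.op (S.comp₁ W) - S.Chalf (S.A.opToHalf (S.comp₃ W)))
    (S.Cstar (S.comp₂ W) - S.A.op (S.comp₃ W)))
    (S.vec₀ (S.A₁.opToHalf (S.comp₁ W)) (Half.incl S.A₁ (S.comp₂ W)) (S.comp₃ W))).re ≤ 0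
  have h1 := S.re_inner_op (S.comp₁ W) (S.comp₂ W) (S.A.opToHalf (S.comp₃ W))
  obtain ⟨m, hm, h2⟩ := S.A.pos
  have h3 := h2 (S.comp₃ W)
  have h4 : 0 ≤ m * ‖(S.comp₃ W : H₂)‖ ^ 2 := by positivity
  have h5 : Half.incl S.A (S.A.opToHalf (S.comp₃ W)) = S.comp₃ W := rfl
  rw [h5] at h1
  rw [inner_vec₀, inner_sub_left (S.Cstar _), ← add_sub_assoc, Complex.sub_re, h1]
  linarith

theorem isMaxDissipative_op₀ (S : ThermoElastic H₁ H₂) : S.op₀.IsMaxDissipative where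
  dissipative := S.isDissipative_op₀
  surjective l hl F := by
    obtain ⟨u₁, p, q, h1, h2, h3⟩ := S.exists_resolvent_solution hl one_pos F.fst.fst F.fst.snd
      (S.A.invSqrt F.snd)
    -- The value that the third equation prescribes for `A v`. The reduced equation says `q =
    -- A^(-1/2) y`, which lifts `v = A^(-1/2) q` from `H_{2,1/2}` to `D(A)`.
    set y : H₂ := F.snd - (l : ℂ) • S.A.invSqrt q + S.Cstar (S.A₁.toHalf p) with hy
    have hq : q = S.A.invSqrt y := by
      rw [hy, map_add, map_sub, map_smul, ← h3, Complex.ofReal_one]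
      module
    have hv : S.A.opToHalf ⟨S.A.inv y, S.A.inv_mem y⟩ = S.A.toHalf q := by
      rw [hq, toHalf_invSqrt]
    have hv' : S.A.inv y = S.A.invSqrt q := by rw [hq, invSqrt_invSqrt]
    obtain ⟨x, hx1, hx2⟩ := (LinearPMap.mem_graph_iff _).1
      (S.mem_graph_op₀ u₁ (S.A₁.toHalf p) ⟨S.A.inv y, S.A.inv_mem y⟩)
    refine ⟨x, ?_⟩
    simp only at hx1 hx2
    rw [hx1, hx2, hv, op_inv]
    have e1 : (l : ℂ) • S.A₁.invSqrt p - (-S.A₁.op u₁ - S.Chalf (S.A.toHalf q)) = F.fst.snd := by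
      rw [← h2]; abel
    have e2 : (l : ℂ) • S.A.inv y - (S.Cstar (S.A₁.toHalf p) - y) = F.snd := by
      rw [hv', hy]; abel
    change S.vec₀ ((l : ℂ) • S.A₁.opToHalf u₁ - S.A₁.toHalf p)
      ((l : ℂ) • S.A₁.invSqrt p - (-S.A₁.op u₁ - S.Chalf (S.A.toHalf q)))
      ((l : ℂ) • S.A.inv y - (S.Cstar (S.A₁.toHalf p) - y)) = F
    rw [h1, e1, e2]
    rfl

/-! ### The operator `𝒜_d` and its closure -/

section Delayed

variable (S : ThermoElastic H₁ H₂) (τ : {τ : ℝ // 0 < τ})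

theorem mem_graph_opD (u₁ : S.A₁.op.domain) (u₂ : S.A₁.Half) (v : S.A.Half) (w : S.A₁.Half) :
    (S.vec τ (S.A₁.opToHalf u₁) (Half.incl S.A₁ u₂) (Half.incl S.A v) (Half.incl S.A₁ w),
      S.vec τ u₂ (-S.A₁.op u₁ - S.Chalf v) (S.Cstar u₂ - S.A₂half w)
        ((τ.1 : ℂ)⁻¹ • S.A₂star v - (τ.1 : ℂ)⁻¹ • Half.incl S.A₁ w)) ∈ (S.opD τ).graph :=
  (LinearPMap.mem_graph_iff _).2
    ⟨⟨S.vec τ (S.A₁.opToHalf u₁) (Half.incl S.A₁ u₂) (Half.incl S.A v) (Half.incl S.A₁ w),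
      u₁.2, u₂.2, v.2, w.2⟩, rfl, rfl⟩

/-- The weight `τ` of `H₁^τ` removes the factor `1/τ`, so `A₂` and `A₂*` cancel and `-‖w‖²` remains.
-/
theorem isDissipative_opD : (S.opD τ).IsDissipative := by
  intro W
  change (inner ℂ (S.vec τ (S.compD₂ τ W)
          (-S.A₁.op (S.compD₁ τ W) - S.Chalf (S.compD₃ τ W))
          (S.Cstar (S.compD₂ τ W) - S.A₂half (S.compD₄ τ W))
          ((τ.1 : ℂ)⁻¹ • S.A₂star (S.compD₃ τ W)
            - (τ.1 : ℂ)⁻¹ • Half.incl S.A₁ (S.compD₄ τ W)))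
    (S.vec τ (S.A₁.opToHalf (S.compD₁ τ W)) (Half.incl S.A₁ (S.compD₂ τ W))
      (Half.incl S.A (S.compD₃ τ W)) (Half.incl S.A₁ (S.compD₄ τ W)))).re ≤ 0
  generalize S.compD₁ τ W = u₁
  generalize S.compD₂ τ W = u₂
  generalize S.compD₃ τ W = v
  generalize S.compD₄ τ W = w
  have h1 := S.re_inner_op u₁ u₂ v
  have hτ : (τ.1 : ℂ) ≠ 0 := by exact_mod_cast τ.2.ne'
  have h2 : (inner ℂ (Half.incl S.A₁ w) (Half.incl S.A₁ w)).re
      = ‖Half.incl S.A₁ w‖ * ‖Half.incl S.A₁ w‖ := inner_self_eq_norm_mul_norm (𝕜 := ℂ) _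
  have h3 : (inner ℂ (S.A₂half w) (Half.incl S.A v)).re
      = (inner ℂ (Half.incl S.A v) (S.A₂half w)).re := by
    rw [← inner_conj_symm, Complex.conj_re]
  rw [inner_vec, ← smul_sub, inner_smul_left, map_inv₀, Complex.conj_ofReal,
    mul_inv_cancel_left₀ hτ, inner_sub_left (S.A₂star v), inner_sub_left (S.Cstar _),
    inner_A₂star_incl, ← add_sub_assoc, ← add_sub_assoc, Complex.sub_re, Complex.add_re,
    Complex.sub_re, h1, h2, h3]
  nlinarith [norm_nonneg (Half.incl S.A₁ w)]

theorem dense_domainD : Dense ((S.opD τ).domain : Set (S.Space τ)) := by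
  rw [Submodule.dense_iff_topologicalClosure_eq_top, Submodule.topologicalClosure_eq_top_iff,
    Submodule.eq_bot_iff]
  intro Y hY
  rw [Submodule.mem_orthogonal] at hY
  have key : ∀ (u₁ : S.A₁.op.domain) (u₂ : S.A₁.Half) (v : S.A.Half) (w : S.A₁.Half),
      inner ℂ (Half.root S.A₁ (S.A₁.opToHalf u₁)) (Half.root S.A₁ Y.fst.fst)
        + inner ℂ (Half.incl S.A₁ u₂) Y.fst.snd + inner ℂ (Half.incl S.A v) Y.snd.fst
        + (τ.1 : ℂ) * inner ℂ (Half.incl S.A₁ w) (Scaled.toBase τ H₁ Y.snd.snd) = 0 := by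
    intro u₁ u₂ v w
    rw [← S.inner_vec]
    exact hY (S.vec τ (S.A₁.opToHalf u₁) (Half.incl S.A₁ u₂) (Half.incl S.A v) (Half.incl S.A₁ w))
      ⟨u₁.2, u₂.2, v.2, w.2⟩
  have hτ : (τ.1 : ℂ) ≠ 0 := by exact_mod_cast τ.2.ne'
  have h1 : Y.fst.fst = 0 := by
    refine Half.root_injective S.A₁ ?_
    rw [map_zero]
    refine S.A₁.eq_zero_of_forall_inner_invSqrt fun y => ?_
    have := key ⟨S.A₁.inv y, S.A₁.inv_mem y⟩ 0 0 0
    simpa [root_opToHalf, op_inv] using this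
  have h2 : Y.fst.snd = 0 := S.A₁.eq_zero_of_forall_inner_invSqrt fun y => by
    simpa [incl_toHalf] using key 0 (S.A₁.toHalf y) 0 0
  have h3 : Y.snd.fst = 0 := S.A.eq_zero_of_forall_inner_invSqrt fun y => by
    simpa [incl_toHalf] using key 0 0 (S.A.toHalf y) 0
  have h4 : Scaled.toBase τ H₁ Y.snd.snd = 0 := S.A₁.eq_zero_of_forall_inner_invSqrt fun y => by
    simpa [incl_toHalf, hτ] using key 0 0 0 (S.A₁.toHalf y)
  change S.vec τ Y.fst.fst Y.fst.snd Y.snd.fst (Scaled.toBase τ H₁ Y.snd.snd) = 0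
  rw [h1, h2, h3, h4]
  rfl

theorem isClosable_opD : (S.opD τ).IsClosable :=
  (S.isDissipative_opD τ).isClosable (S.dense_domainD τ)

theorem continuous_vec (u₁ : S.A₁.Half) (u₂ : H₁) (v : H₂) :
    Continuous fun w => S.vec τ u₁ u₂ v w := by
  have h1 : Continuous (Scaled.toBase τ H₁).symm :=
    (LipschitzWith.of_dist_le_mul (K := (√τ.1).toNNReal) fun w z => by
      rw [dist_eq_norm, dist_eq_norm, ← map_sub, Scaled.norm_eq, LinearEquiv.apply_symm_apply,
        Real.coe_toNNReal _ (Real.sqrt_nonneg _)]).continuous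
  exact (WithLp.prod_continuous_toLp 2 _ _).comp (continuous_const.prodMk
    ((WithLp.prod_continuous_toLp 2 _ _).comp (continuous_const.prodMk h1)))

/-- Approximate `w` in `H₁` by elements of `H_{1,1/2}` with exactly the same `A₂ w = f`. The only
unbounded term in `w` stays constant, so both entries of the pair depend continuously on the
approximation. -/
theorem mem_graph_closure_opD (u₁ : S.A₁.op.domain) (u₂ : S.A₁.Half) (v : S.A.Half) {w : H₁}
    {f : H₂} (h : S.A₂ w = S.A.pivot f) :
    (S.vec τ (S.A₁.opToHalf u₁) (Half.incl S.A₁ u₂) (Half.incl S.A v) w,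
      S.vec τ u₂ (-S.A₁.op u₁ - S.Chalf v) (S.Cstar u₂ - f)
        ((τ.1 : ℂ)⁻¹ • S.A₂star v - (τ.1 : ℂ)⁻¹ • w)) ∈ (S.opD τ).closure.graph := by
  rw [← (S.isClosable_opD τ).graph_closure_eq_closure_graph]
  refine map_mem_closure (t := (S.opD τ).graph)
    (f := fun z => (S.vec τ (S.A₁.opToHalf u₁) (Half.incl S.A₁ u₂) (Half.incl S.A v) z,
      S.vec τ u₂ (-S.A₁.op u₁ - S.Chalf v) (S.Cstar u₂ - f)
        ((τ.1 : ℂ)⁻¹ • S.A₂star v - (τ.1 : ℂ)⁻¹ • z)))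
    ((S.continuous_vec τ _ _ _).prodMk ((S.continuous_vec τ _ _ _).comp (by fun_prop)))
    (S.mem_closure_of_A₂_eq_pivot h) ?_
  rintro _ ⟨u, rfl, rfl⟩
  exact S.mem_graph_opD τ u₁ u₂ v u

theorem exists_resolvent_opD {l : ℝ} (hl : 0 < l) (F : S.Space τ) :
    ∃ (u₁ : S.A₁.op.domain) (u₂ : S.A₁.Half) (v : S.A.Half) (w : H₁) (f : H₂),
      S.A₂ w = S.A.pivot f ∧
      (l : ℂ) • S.vec τ (S.A₁.opToHalf u₁) (Half.incl S.A₁ u₂) (Half.incl S.A v) w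
        - S.vec τ u₂ (-S.A₁.op u₁ - S.Chalf v) (S.Cstar u₂ - f)
          ((τ.1 : ℂ)⁻¹ • S.A₂star v - (τ.1 : ℂ)⁻¹ • w) = F := by
  have hτ : (τ.1 : ℂ) ≠ 0 := by exact_mod_cast τ.2.ne'
  have hlτ : 0 < 1 + l * τ.1 := by have := τ.2; positivity
  have hlτ' : (1 + l * τ.1 : ℂ) ≠ 0 := by exact_mod_cast hlτ.ne'
  set k : ℂ := (1 + l * τ.1 : ℂ)⁻¹ with hk
  have hk' : (((1 + l * τ.1)⁻¹ : ℝ) : ℂ) = k := by push_cast; rfl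
  set f₄ : H₁ := Scaled.toBase τ H₁ F.snd.snd with hf₄
  -- The last equation gives `w = k (τ f₄ + G q)`. As `G* G = 1`, the term `A^(-1/2) A₂ w = G* w`
  -- equals `k q + k τ G* f₄`: the first summand is the coercive term, the second joins the data.
  obtain ⟨u₁, p, q, h1, h2, h3⟩ := S.exists_resolvent_solution hl (inv_pos.2 hlτ)
    F.fst.fst F.fst.snd (S.A.invSqrt F.snd.fst - (k * τ.1) • S.gradient.adjoint f₄)
  rw [hk'] at h3
  set w : H₁ := k • ((τ.1 : ℂ) • f₄ + S.gradient q) with hw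
  -- The value that the third equation prescribes for `A₂ w`; the reduced equation is precisely `G*
  -- w = A^(-1/2) f`.
  set f : H₂ := F.snd.fst - (l : ℂ) • S.A.invSqrt q + S.Cstar (S.A₁.toHalf p) with hf
  refine ⟨u₁, S.A₁.toHalf p, S.A.toHalf q, w, f, ?_, ?_⟩
  · rw [A₂_eq_pivot_iff, hw, hf]
    simp only [map_smul, map_add, map_sub, adjoint_gradient_gradient]
    linear_combination (norm := module) (1 : ℂ) • h3
  · have e1 : (l : ℂ) • S.A₁.invSqrt p - (-S.A₁.op u₁ - S.Chalf (S.A.toHalf q)) = F.fst.snd := by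
      rw [← h2]; abel
    have e2 : (l : ℂ) • S.A.invSqrt q - (S.Cstar (S.A₁.toHalf p) - f) = F.snd.fst := by
      rw [hf]; abel
    have e3 : (l : ℂ) • w - ((τ.1 : ℂ)⁻¹ • S.gradient q - (τ.1 : ℂ)⁻¹ • w) = f₄ := by
      have h5 : (l : ℂ) • w + (τ.1 : ℂ)⁻¹ • w = ((τ.1 : ℂ)⁻¹ * (1 + l * τ.1)) • w := by
        rw [← add_smul]
        congr 1
        field_simp
        ring
      have h6 : ((1 + l * τ.1 : ℂ)) • w = (τ.1 : ℂ) • f₄ + S.gradient q := by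
        rw [hw, hk, smul_inv_smul₀ hlτ']
      rw [sub_sub_eq_add_sub, add_sub_right_comm, sub_add_eq_add_sub, h5, mul_smul, h6, smul_add,
        inv_smul_smul₀ hτ, add_sub_cancel_right]
    change S.vec τ ((l : ℂ) • S.A₁.opToHalf u₁ - S.A₁.toHalf p)
      ((l : ℂ) • S.A₁.invSqrt p - (-S.A₁.op u₁ - S.Chalf (S.A.toHalf q)))
      ((l : ℂ) • S.A.invSqrt q - (S.Cstar (S.A₁.toHalf p) - f))
      ((l : ℂ) • w - ((τ.1 : ℂ)⁻¹ • S.gradient q - (τ.1 : ℂ)⁻¹ • w)) = F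
    rw [h1, e1, e2, e3]
    rfl

theorem isMaxDissipative_closure_opD : (S.opD τ).closure.IsMaxDissipative where
  dissipative := (S.isDissipative_opD τ).closure (S.isClosable_opD τ)
  surjective l hl F := by
    obtain ⟨u₁, u₂, v, w, f, hf, hF⟩ := S.exists_resolvent_opD τ hl F
    obtain ⟨x, hx1, hx2⟩ := (LinearPMap.mem_graph_iff _).1
      (S.mem_graph_closure_opD τ u₁ u₂ v hf)
    exact ⟨x, by rw [hx1, hx2]; exact hF⟩

theorem isMaxDissipative_opD (h : S.A₂DomainEqHalf) : (S.opD τ).IsMaxDissipative where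
  dissipative := S.isDissipative_opD τ
  surjective l hl F := by
    obtain ⟨u₁, u₂, v, w, f, hf, hF⟩ := S.exists_resolvent_opD τ hl F
    have hw : w ∈ S.A₁.sqrt.domain := h w ⟨f, hf⟩
    have hf' : S.A₂half (Half.ofMem w hw) = f :=
      S.A.pivot_injective ((S.A₂half_eq _).symm.trans hf)
    obtain ⟨x, hx1, hx2⟩ := (LinearPMap.mem_graph_iff _).1
      (S.mem_graph_opD τ u₁ u₂ v (Half.ofMem w hw))
    rw [hf'] at hx2
    exact ⟨x, by rw [hx1, hx2]; exact hF⟩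

/-- For `w` in the natural domain, `(0, 0, 0, w)` lies in the domain of the closure, hence in
`D(𝒜_d)` itself. -/
theorem A₂DomainEqHalf_of_isClosed (h : (S.opD τ).IsClosed) : S.A₂DomainEqHalf := by
  rintro w ⟨f, hf⟩
  have h1 := S.mem_graph_closure_opD τ 0 0 0 hf
  rw [← (S.isClosable_opD τ).graph_closure_eq_closure_graph,
    h.submodule_topologicalClosure_eq] at h1
  obtain ⟨x, hx, -⟩ := (LinearPMap.mem_graph_iff _).1 h1
  have h2 := x.2.2.2.2
  rw [hx] at h2
  exact h2

end Delayed

end ThermoElastic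

end

theorem theorem2p1 {H₁ H₂ : Type*} [NormedAddCommGroup H₁] [InnerProductSpace ℂ H₁]
    [CompleteSpace H₁] [NormedAddCommGroup H₂] [InnerProductSpace ℂ H₂] [CompleteSpace H₂]
    (S : ThermoElastic H₁ H₂) (τ : ℝ) (hτ : 0 < τ) :
    (GeneratesContractionSemigroup (S.opD ⟨τ, hτ⟩) ↔ S.A₂DomainEqHalf) ∧
    ((S.opD ⟨τ, hτ⟩).IsClosable ∧ GeneratesContractionSemigroup (S.opD ⟨τ, hτ⟩).closure) ∧
    GeneratesContractionSemigroup S.op₀ :=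
  ⟨⟨fun h => S.A₂DomainEqHalf_of_isClosed _ h.isClosed,
      fun h => (S.isMaxDissipative_opD _ h).generatesContractionSemigroup⟩,
    ⟨S.isClosable_opD _, (S.isMaxDissipative_closure_opD _).generatesContractionSemigroup⟩,
    S.isMaxDissipative_op₀.generatesContractionSemigroup⟩
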